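/- Let $\mathcal H$ be a finite-dimensional complex Hilbert space, $t\ge 0$, $p\ge 1$, and let $H(\tau)=\sum_{\gamma=1}^{\Gamma}H_\gamma(\tau)$, where each $H_\gamma$ is a Hermitian-operator-valued function that is $(p+2)$-times differentiable on $[0,t]$. Let $U(s,s_0)=\mathcal T\exp\left(-i\int_{s_0}^{s}H(x)\,dx\right)$ and $U_\gamma(s,s_0)=\mathcal T\exp\left(-i\int_{s_0}^{s}H_\gamma(x)\,dx\right)$ (for $s<s_0$, $U_\gamma(s,s_0)=U_\gamma(s_0,s)^\dagger$). Consider a time-dependent product formula $$S(s,0)=U_{\gamma_K}(\beta_Ks+\alpha_Ks,\beta_Ks)\cdots U_{\gamma_1}(\beta_1s+\alpha_1s,\beta_1s),\qquad K\ge 1,\ \gamma_k\in\{1,\dots,\Gamma\},$$ with real numbers $\alpha_k\in[-1,1]$ and $\beta_k$ such that $\sum_{k:\gamma_k=\gamma}\alpha_k=1$ for every $\gamma$, $\beta_1=0$, $\beta_K+\alpha_K=1$, $0\le\beta_k\le1$ and $0\le\beta_k+\alpha_k\le1$. Suppose that it consists of $V=K/\Gamma$ layers, in the sense that every $\gamma\in\{1,\dots,\Gamma\}$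 occurs exactly $V$ times among $\gamma_1,\dots,\gamma_K$. Suppose that the formula is of order $p$, in at least one of the following two senses: (a) the time-independent counterpart $$T(s)=e^{-iA_{\gamma_K}\alpha_Ks}\prod_{k=1,\dots,K-1}^{\leftarrow}\left(e^{-iA_0(\beta_k+\alpha_k-\beta_{k+1})s}\,e^{-iA_{\gamma_k}\alpha_ks}\right)$$ (factors with larger $k$ stand further left) satisfies $$T(s)=\exp\left(-is\left(\sum_{\gamma=1}^{\Gamma}A_\gamma+(\Gamma-1)A_0\right)\right)+O(s^{p+1})\quad(s\to0^+)$$ for all Hermitian operators $A_0,A_1,\dots,A_\Gamma$ on every finite-dimensional Hilbert space; (b) for the given $H_1,\dots,H_\Gamma$, $U(s,0)=S(s,0)+O(s^{p+1})$ as $s\to0^+$. For $\tau\in[0,t]$ put $$\alpha_{\mathrm{com}}^{p+1}(\tau)=\sum_{\gamma_1,\dots,\gamma_p=1}^{\Gamma+1}\ \sum_{\gamma_{p+1}=1}^{\Gamma}\left\|\mathcal D_{\gamma_p}\cdots\mathcal D_{\gamma_1}H_{\gamma_{p+1}}(\tau)\right\|,\qquad \mathcal D_\gamma=\begin{cases}\mathrm{ad}_{H_\gamma(\tau)}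 & (1\le\gamma\le\Gamma),\\ 2\Gamma\,\dfrac{d}{d\tau} & (\gamma=\Gamma+1),\end{cases}$$ where $\mathrm{ad}_AB=AB-BA$, $\|\cdot\|$ is the operator norm, and derivatives at the end points of $[0,t]$ are one-sided. Then the maximum of $\alpha_{\mathrm{com}}^{p+1}$ over $[0,t]$ is attained and $$\|U(t,0)-S(t,0)\|\le 3V^{p+1}\,\max_{\tau\in[0,t]}\alpha_{\mathrm{com}}^{p+1}(\tau)\;t^{p+1}.$$ -/

import Mathlib

open Set Filter Topology Asymptotics

noncomputable section

namespace TimeDepPF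

variable {E : Type*} [NormedAddCommGroup E] [InnerProductSpace ℂ E]

/-- The `n`-th term of the Dyson series of `𝒯 exp (-i ∫_{s₀}^s H)`, as a function of `s`.
The integrals are oriented, so `s < s₀` is allowed and gives backward evolution. -/
def dysonTerm (H : ℝ → E →L[ℂ] E) (s₀ : ℝ) : ℕ → ℝ → E →L[ℂ] E
  | 0, _ => 1
  | n + 1, s => (-Complex.I) • ∫ x in s₀..s, H x * dysonTerm H s₀ n x

/-- The time-evolution operator `U(s, s₀) = 𝒯 exp (-i ∫_{s₀}^s H(x) dx)`. -/
def timeEvolution (H : ℝ → E →L[ℂ] E) (s s₀ : ℝ) : E →L[ℂ] E :=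
  ∑' n, dysonTerm H s₀ n s

/-- The data of a product formula with `K` factors for a decomposition into `Γ` terms: factor `k`
evolves under term `γ k` from time `β k * t` to time `(β k + α k) * t`. -/
structure ProductFormula (Γ K : ℕ) where
  K_pos : 0 < K
  γ : Fin K → Fin Γ
  α : Fin K → ℝ
  β : Fin K → ℝ
  abs_α_le : ∀ k, |α k| ≤ 1
  sum_α : ∀ g, ∑ k with γ k = g, α k = 1
  β_first : β ⟨0, K_pos⟩ = 0
  β_add_α_last : β ⟨K - 1, Nat.sub_lt K_pos Nat.one_pos⟩
    + α ⟨K - 1, Nat.sub_lt K_pos Nat.one_pos⟩ = 1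
  β_mem : ∀ k, β k ∈ Icc (0 : ℝ) 1
  β_add_α_mem : ∀ k, β k + α k ∈ Icc (0 : ℝ) 1

namespace ProductFormula

variable {Γ K : ℕ}

/-- The factors can be grouped into `V` layers: each of the `Γ` terms occurs `V` times,
in any order (so that `K = V * Γ`). -/
def HasLayers (F : ProductFormula Γ K) (V : ℕ) : Prop :=
  ∀ g, (Finset.univ.filter fun k => F.γ k = g).card = V

/-- The time-dependent product formula `S(t, 0)`; the factor `k = 0` stands rightmost. -/
def S (F : ProductFormula Γ K) (H : Fin Γ → ℝ → E →L[ℂ] E) (t : ℝ) : E →L[ℂ] E :=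
  (List.ofFn fun k : Fin K =>
    timeEvolution (H (F.γ k)) (F.β k * t + F.α k * t) (F.β k * t)).reverse.prod

/-- The time-independent counterpart of the formula: between the factors `k` and `k + 1` an
evolution under an additional term `H₀` for the time `(β k + α k - β (k + 1)) t` is inserted. -/
def T (F : ProductFormula Γ K) (H₀ : E →L[ℂ] E) (H : Fin Γ → E →L[ℂ] E) (t : ℝ) : E →L[ℂ] E :=
  (List.ofFn fun k : Fin K =>
    (if h : (k : ℕ) + 1 < K then
      NormedSpace.exp ((-Complex.I * ((F.β k + F.α k - F.β ⟨k + 1, h⟩) * t : ℝ)) • H₀)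
    else 1) *
    NormedSpace.exp ((-Complex.I * (F.α k * t : ℝ)) • H (F.γ k))).reverse.prod

/-- The time-independent counterpart has order `p`: for all Hermitian `H₀, H_1, …, H_Γ` on all
finite-dimensional Hilbert spaces, `T(t)` equals the exponential of
`-i t (H_1 + ⋯ + H_Γ + (Γ - 1) H₀)` up to `O(t^{p+1})`. (The times under `H₀` add up to
`(Γ - 1) t`.) -/
def CounterpartHasOrder (F : ProductFormula Γ K) (p : ℕ) : Prop :=
  ∀ (W : Type) [NormedAddCommGroup W] [InnerProductSpace ℂ W] [FiniteDimensional ℂ W]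
    (H₀ : W →L[ℂ] W) (H : Fin Γ → W →L[ℂ] W),
    H₀.IsSymmetric → (∀ g, (H g).IsSymmetric) →
    (fun t : ℝ => NormedSpace.exp ((-Complex.I * (t : ℂ)) • (∑ g, H g + ((Γ : ℂ) - 1) • H₀))
        - F.T H₀ H t) =O[𝓝[>] 0] fun t => t ^ (p + 1)

/-- `S` has order `p` for the given time-dependent terms: `U(s,0) = S(s,0) + O(s^{p+1})`. -/
def HasOrderFor (F : ProductFormula Γ K) (H : Fin Γ → ℝ → E →L[ℂ] E) (p : ℕ) : Prop :=
  (fun s : ℝ => timeEvolution (fun x => ∑ g, H g x) s 0 - F.S H s) =O[𝓝[>] 0]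
    fun s => s ^ (p + 1)

end ProductFormula

variable {Γ : ℕ}

/-- The operations on time-dependent operators on `[0, t]`: `ad_{H_g(τ)}` for the index `some g`,
and `2 Γ d/dτ` for the extra index `none` (the index `Γ + 1`). -/
def nestedOp (H : Fin Γ → ℝ → E →L[ℂ] E) (t : ℝ) :
    Option (Fin Γ) → (ℝ → E →L[ℂ] E) → ℝ → E →L[ℂ] E
  | some g, X => fun τ => H g τ * X τ - X τ * H g τ
  | none, X => fun τ => (2 * Γ : ℝ) • derivWithin X (Icc 0 t) τ

/-- The commutator factor `α_com^{p+1}(τ)`. -/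
def alphaCom (H : Fin Γ → ℝ → E →L[ℂ] E) (t : ℝ) (p : ℕ) (τ : ℝ) : ℝ :=
  ∑ w : Fin p → Option (Fin Γ), ∑ g : Fin Γ,
    ‖(List.ofFn w).foldl (fun X i => nestedOp H t i X) (H g) τ‖

end TimeDepPF

end

/-! Put `W(s) = U(s,0)† S(s,0)`. The product formula solves `S' = -i Q S`, where `Q` (`factorGen`)
is a sum of conjugated terms: each factor contributes its end time times `H_γ` at that time,
conjugated by the later factors, minus its start time times `H_γ` at that time, conjugated by the
later factors and itself. Hence `W' = U† (-i)(Q - H) S`. By unitarity it suffices to show `‖Q(s) -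
H(s)‖ ≤ 3 V^(p+1) M s^p`, where `M` is the maximum of the commutator factor.

Each summand of `Q`, and `H(s)` itself, is an operator-valued function transported along a path of
times down to `0`. A factor transports by conjugation, with generator `d/dx + i ad_{H_γ}`; the jump
from the end of a factor to the start of the next is a shift, with generator `d/dx`. Iterating
Taylor's formula along the path (`norm_chainVal_sub_le`) gives a polynomial in `s` of degree below
`p` with constant coefficients, and a remainder controlled by words of `p` generators. One pass
through the formula meets each `ad_{H_γ}` `V` times and `d/dx` `2ΓV` times: `V` times per term from
the factors and as often from the shifts. This is the weight `2Γ` in the commutator factor, and it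
yields `V^p` (`HasLayers.listNorm_le`). The two summands per factor give another `2V`, the expansion
of `H` gives `1`, and `2V + 1 ≤ 3V`.

The polynomial part of `Q - H` vanishes because the formula has order `p`: its lowest nonzero
coefficient would survive integration of `W'` and contradict `W - 1 = O(s^(p+1))`
(`coeff_eq_zero_of_hasDerivAt`).

If the order is assumed for the time-independent counterpart, it is first transferred to the given
Hamiltonians. Left multiplication by evolutions is also a transport, with generator `d/dx + i H_γ`,
so the Taylor coefficients of `S` and `U` are noncommutative polynomials in these generators applied
to the constant function `1`. They are the polynomials of the counterpart, with `d/dx` in the role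
of the additional term. The order condition on a truncated Fock space forces the polynomials to
agree for all linear operators (`chainPoly_eq_totalPoly_of_fock`).

Everything is carried out for `C^p` Hermitian functions on the whole line that extend the given
ones. -/

noncomputable section

namespace TimeDepPF

/-! ### Taylor expansion of propagators along a path of times -/

/-- The sum of norms in which the words of length `q` in the operators `D g`, `g ∈ l`, are applied
to `f` in the order prescribed by `l`, evaluated at `x`. -/
def sortedNorm {X : Type*} [NormedAddCommGroup X] [NormedSpace ℝ X] {ι : Type*}
    (D : ι → Module.End ℝ (ℝ → X)) : List ι → ℕ → (ℝ → X) → ℝ → ℝ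
  | _, 0, f, x => ‖f x‖
  | [], _ + 1, _, _ => 0
  | g :: l, q + 1, f, x => sortedNorm D (g :: l) q (D g f) x + sortedNorm D l (q + 1) f x
termination_by l q => l.length + q

/-- The `n`-th coefficient in `s` of the ordered product of the exponentials
`exp ((x₀ - x) s D_g)` along a path that starts at `x₀` and has the segments `(g, x)`. -/
def chainPoly {R : Type*} [Ring R] [Algebra ℝ R] {ι : Type*} (D : ι → R) :
    ℝ → List (ι × ℝ) → ℕ → R
  | _, [], n => if n = 0 then 1 else 0
  | x₀, (g, x) :: l, n => ∑ ij ∈ Finset.HasAntidiagonal.antidiagonal n,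
      ((x₀ - x) ^ ij.1 / (ij.1.factorial : ℝ)) • (chainPoly D x l ij.2 * D g ^ ij.1)

/-- The end point of a path. -/
def chainEnd {ι : Type*} : ℝ → List (ι × ℝ) → ℝ
  | x₀, [] => x₀
  | _, (_, x) :: l => chainEnd x l

section

variable {X : Type*} [NormedAddCommGroup X] [NormedSpace ℝ X] {ι : Type*}

/-- Composition of propagators along a path with all times scaled by `s`. -/
def chainVal (Φ : ι → ℝ → ℝ → X →ₗ[ℝ] X) (s : ℝ) : ℝ → List (ι × ℝ) → X →ₗ[ℝ] X
  | _, [] => LinearMap.id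
  | x₀, (g, x) :: l => chainVal Φ s x l ∘ₗ Φ g (x * s) (x₀ * s)

/-- `Φ b a` is a contractive propagator from time `a` to time `b` such that
`d/dx Φ b x (f x) = Φ b x (D f x)`; `D` maps `C^{m+1}` to `C^m` for `m ≤ n`. -/
structure IsPropagator (Φ : ℝ → ℝ → X →ₗ[ℝ] X) (D : Module.End ℝ (ℝ → X)) (n : ℕ) : Prop where
  refl : ∀ b v, Φ b b v = v
  norm_le : ∀ b a v, ‖Φ b a v‖ ≤ ‖v‖
  hasDerivAt : ∀ f : ℝ → X, Differentiable ℝ f → ∀ b x,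
    HasDerivAt (fun x => Φ b x (f x)) (Φ b x (D f x)) x
  continuous : ∀ f : ℝ → X, Continuous f → ∀ b, Continuous fun x => Φ b x (f x)
  contDiff : ∀ m ≤ n, ∀ f : ℝ → X, ContDiff ℝ (m + 1 : ℕ) f → ContDiff ℝ m (D f)

/-- Induction on the order: the derivative of the error is the error of one order less for the
shifted sequence, and the mean value inequality supplies one more factor `|a - b|`. The factorial in
the remainder is given up, and the last derivative enters only through an integrable majorant. -/
theorem norm_sub_taylor_le (n : ℕ) (h : ℕ → ℝ → X)
    (hd : ∀ j ≤ n, ∀ x, HasDerivAt (h j) (h (j + 1) x) x) (hc : Continuous (h (n + 1)))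
    {g : ℝ → ℝ} (hg : Continuous g) (hhg : ∀ x, ‖h (n + 1) x‖ ≤ g x)
    [CompleteSpace X] (b a : ℝ) :
    ‖h 0 a - ∑ j ∈ Finset.range (n + 1), ((a - b) ^ j / (j.factorial : ℝ)) • h j b‖
      ≤ |a - b| ^ n * |∫ x in b..a, g x| := by
  induction n generalizing h a with
  | zero =>
    have hi : ∫ x in b..a, h 1 x = h 0 a - h 0 b :=
      intervalIntegral.integral_eq_sub_of_hasDerivAt (fun x _ => hd 0 le_rfl x)
        (hc.intervalIntegrable _ _)
    simp only [zero_add, Finset.sum_range_one, pow_zero, Nat.factorial_zero, Nat.cast_one, div_one,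
      one_smul, one_mul]
    rw [← hi]
    exact intervalIntegral.norm_integral_le_abs_of_norm_le (Eventually.of_forall hhg)
      (hg.intervalIntegrable _ _)
  | succ n ih =>
    set C := |a - b| ^ n * |∫ x in b..a, g x| with hC
    let e : ℝ → X := fun x => h 0 x -
      ∑ j ∈ Finset.range (n + 2), ((x - b) ^ j / (j.factorial : ℝ)) • h j b
    have hed : ∀ x, HasDerivAt e (h 1 x -
        ∑ j ∈ Finset.range (n + 1), ((x - b) ^ j / (j.factorial : ℝ)) • h (j + 1) b) x := by
      intro x
      refine (hd 0 (by omega) x).sub ?_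
      have : ∀ j ∈ Finset.range (n + 2), HasDerivAt
          (fun x => ((x - b) ^ j / (j.factorial : ℝ)) • h j b)
          (((j : ℝ) * (x - b) ^ (j - 1) / (j.factorial : ℝ)) • h j b) x := by
        intro j _
        have := ((((hasDerivAt_id x).sub_const b).pow j).div_const (j.factorial : ℝ)).smul_const
          (h j b)
        simpa using this
      have h2 := HasDerivAt.fun_sum this
      refine h2.congr_deriv ?_
      rw [Finset.sum_range_succ']
      simp only [Nat.cast_zero, zero_mul, zero_div, zero_smul, add_zero, Nat.add_sub_cancel]
      refine Finset.sum_congr rfl fun j _ => ?_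
      congr 1
      rw [Nat.factorial_succ]
      push_cast
      have : (j : ℝ) + 1 ≠ 0 := by positivity
      field_simp
    have hb : e b = 0 := by
      simp only [e, Finset.sum_range_succ', sub_self]
      simp
    have hle : ∀ x ∈ uIcc b a, ‖h 1 x -
        ∑ j ∈ Finset.range (n + 1), ((x - b) ^ j / (j.factorial : ℝ)) • h (j + 1) b‖ ≤ C := by
      intro x hx
      refine (ih (fun j => h (j + 1)) (fun j hj x => hd (j + 1) (by omega) x) hc hhg x).trans ?_
      have h1 : |x - b| ≤ |a - b| := by
        rw [mem_uIcc] at hx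
        rcases hx with hx | hx
        · rw [abs_of_nonneg (by linarith), abs_of_nonneg (by linarith)]; linarith
        · rw [abs_of_nonpos (by linarith), abs_of_nonpos (by linarith)]; linarith
      have h2 : |∫ x in b..x, g x| ≤ |∫ x in b..a, g x| :=
        intervalIntegral.abs_integral_mono_interval
          (uIoc_subset_uIoc_of_uIcc_subset_uIcc (uIcc_subset_uIcc left_mem_uIcc hx))
          (Eventually.of_forall fun y => (norm_nonneg _).trans (hhg y))
          (hg.intervalIntegrable _ _)
      rw [hC]
      gcongr
    have := (convex_uIcc b a).norm_image_sub_le_of_norm_hasDerivWithin_le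
      (fun x _ => (hed x).hasDerivWithinAt) hle left_mem_uIcc right_mem_uIcc
    rw [hb, sub_zero, Real.norm_eq_abs, hC] at this
    calc _ ≤ _ := this
      _ = _ := by ring

variable {Φ : ℝ → ℝ → X →ₗ[ℝ] X} {D : Module.End ℝ (ℝ → X)} {n : ℕ}

theorem IsPropagator.contDiff_pow (h : IsPropagator Φ D n) {q m : ℕ} (hq : q ≤ n + 1) {f : ℝ → X}
    (hf : ContDiff ℝ q f) {j : ℕ} (hj : j + m = q) : ContDiff ℝ m ((D ^ j) f) := by
  induction j generalizing m with
  | zero => simp only [zero_add] at hj; subst hj; simpa using hf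
  | succ j ih =>
    rw [pow_succ', Module.End.mul_apply]
    exact h.contDiff m (by omega) _ (ih (m := m + 1) (by omega))

theorem IsPropagator.norm_sub_taylor_le [CompleteSpace X] (h : IsPropagator Φ D n) {q : ℕ}
    (hq : q ≤ n) {f : ℝ → X} (hf : ContDiff ℝ (q + 1 : ℕ) f) (b a : ℝ) :
    ‖Φ b a (f a) - ∑ j ∈ Finset.range (q + 1), ((a - b) ^ j / (j.factorial : ℝ)) • (D ^ j) f b‖
      ≤ |a - b| ^ q * |∫ x in b..a, ‖(D ^ (q + 1)) f x‖| := by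
  have hd : ∀ j ≤ q, ∀ x, HasDerivAt (fun x => Φ b x ((D ^ j) f x))
      (Φ b x ((D ^ (j + 1)) f x)) x := by
    intro j hj x
    rw [pow_succ', Module.End.mul_apply]
    refine h.hasDerivAt _ ?_ b x
    have : ContDiff ℝ ((q - j) + 1 : ℕ) ((D ^ j) f) :=
      h.contDiff_pow (q := q + 1) (by omega) hf (by omega)
    exact this.differentiable (by simp)
  have hDc : Continuous ((D ^ (q + 1)) f) :=
    (h.contDiff_pow (q := q + 1) (m := 0) (by omega) hf (by omega)).continuous
  have := TimeDepPF.norm_sub_taylor_le q (fun j x => Φ b x ((D ^ j) f x)) hd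
    (h.continuous _ hDc b) hDc.norm (fun x => h.norm_le b x _) b a
  simpa only [h.refl, pow_zero, Module.End.one_apply] using this

/-- Words are grouped by how often the first letter is used, which is the shape in which remainders
arise when the first segment of a path is expanded. -/
theorem sortedNorm_cons_eq_sum {D : ι → Module.End ℝ (ℝ → X)} (g : ι) (l : List ι) (q : ℕ)
    (f : ℝ → X) (x : ℝ) :
    sortedNorm D (g :: l) q f x = ‖(D g ^ q) f x‖ +
      ∑ j ∈ Finset.range q, sortedNorm D l (q - j) ((D g ^ j) f) x := by
  induction q generalizing f with
  | zero => simp [sortedNorm]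
  | succ q ih =>
    rw [sortedNorm, ih, Finset.sum_range_succ']
    simp [pow_succ, Module.End.mul_apply, add_assoc]

theorem continuous_sortedNorm {Φ : ι → ℝ → ℝ → X →ₗ[ℝ] X} {D : ι → Module.End ℝ (ℝ → X)}
    (h : ∀ g, IsPropagator (Φ g) (D g) n) (l : List ι) {q : ℕ} (hq : q ≤ n + 1)
    {f : ℝ → X} (hf : ContDiff ℝ q f) : Continuous (sortedNorm D l q f) := by
  induction l generalizing q f with
  | nil =>
    cases q with
    | zero => simpa only [funext fun x => sortedNorm.eq_1 D [] f x] using hf.continuous.norm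
    | succ q => simpa only [funext fun x => sortedNorm.eq_2 D f x q] using continuous_const
  | cons g l ih =>
    simp only [funext fun x => sortedNorm_cons_eq_sum (D := D) g l q f x]
    refine Continuous.add ?_ (continuous_finsetSum _ fun j hj => ?_)
    · exact ((h g).contDiff_pow (m := 0) hq hf (by omega)).continuous.norm
    · rw [Finset.mem_range] at hj
      exact ih (by omega) ((h g).contDiff_pow hq hf (by omega))

theorem norm_chainVal_le {Φ : ι → ℝ → ℝ → X →ₗ[ℝ] X} (hΦ : ∀ g b a v, ‖Φ g b a v‖ ≤ ‖v‖)
    (s x₀ : ℝ) (l : List (ι × ℝ)) (v : X) : ‖chainVal Φ s x₀ l v‖ ≤ ‖v‖ := by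
  induction l generalizing x₀ v with
  | nil => simp [chainVal]
  | cons y l ih => exact (ih _ _).trans (hΦ _ _ _ _)

/-- Taylor's formula along a path. -/
theorem norm_chainVal_sub_le [CompleteSpace X] {Φ : ι → ℝ → ℝ → X →ₗ[ℝ] X}
    {D : ι → Module.End ℝ (ℝ → X)} (h : ∀ g, IsPropagator (Φ g) (D g) n) {q : ℕ} (hq : q ≤ n)
    {f : ℝ → X} (hf : ContDiff ℝ (q + 1 : ℕ) f) {s : ℝ} (hs : 0 ≤ s) {x₀ : ℝ}
    (hx₀ : x₀ ∈ Icc (0 : ℝ) 1) (l : List (ι × ℝ)) (hl : ∀ y ∈ l, y.2 ∈ Icc (0 : ℝ) 1) :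
    ‖chainVal Φ s x₀ l (f (x₀ * s)) -
        ∑ m ∈ Finset.range (q + 1), s ^ m • chainPoly D x₀ l m f (chainEnd x₀ l * s)‖
      ≤ s ^ q * ∫ x in 0..s, sortedNorm D (l.map Prod.fst) (q + 1) f x := by
  induction l generalizing x₀ q f with
  | nil =>
    rw [Finset.sum_eq_single_of_mem 0 (by simp) (by
      intro m _ hm; simp [chainPoly, hm])]
    simp [chainVal, chainPoly, chainEnd, sortedNorm]
  | cons y l ih =>
    obtain ⟨g, x⟩ := y
    have hx : x ∈ Icc (0 : ℝ) 1 := hl (g, x) (by simp)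
    have hl' : ∀ y ∈ l, y.2 ∈ Icc (0 : ℝ) 1 := fun y hy => hl y (by simp [hy])
    have hreg : ∀ j ≤ q, ContDiff ℝ ((q - j) + 1 : ℕ) ((D g ^ j) f) := fun j hj =>
      (h g).contDiff_pow (q := q + 1) (by omega) hf (by omega)
    set c : ℕ → ℝ := fun j => (x₀ * s - x * s) ^ j / (j.factorial : ℝ) with hc
    have habs : |x₀ * s - x * s| ≤ s := by
      rw [← sub_mul, abs_mul, abs_of_nonneg hs]
      refine mul_le_of_le_one_left hs ?_
      rw [abs_le]; constructor <;> linarith [hx.1, hx.2, hx₀.1, hx₀.2]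
    have hcs : ∀ j, |c j| ≤ s ^ j := by
      intro j
      rw [hc, abs_div, abs_pow, Nat.abs_cast]
      refine (div_le_self (by positivity) (by exact_mod_cast Nat.factorial_pos j)).trans ?_
      gcongr
    have hDc : Continuous ((D g ^ (q + 1)) f) :=
      ((h g).contDiff_pow (q := q + 1) (m := 0) (by omega) hf (by omega)).continuous
    have hrem := (h g).norm_sub_taylor_le hq hf (x * s) (x₀ * s)
    have hint : |∫ y in x * s..x₀ * s, ‖(D g ^ (q + 1)) f y‖| ≤
        ∫ y in 0..s, ‖(D g ^ (q + 1)) f y‖ := by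
      rw [← abs_of_nonneg (intervalIntegral.integral_nonneg hs fun y _ =>
        norm_nonneg ((D g ^ (q + 1)) f y))]
      refine intervalIntegral.abs_integral_mono_interval
        (uIoc_subset_uIoc_of_uIcc_subset_uIcc (uIcc_subset_uIcc ?_ ?_))
        (Eventually.of_forall fun y => norm_nonneg _) (hDc.norm.intervalIntegrable _ _)
      all_goals
        rw [uIcc_of_le hs]
        constructor <;> nlinarith [hx.1, hx.2, hx₀.1, hx₀.2]
    -- The coefficients of the whole path are a Cauchy product of those of the first segment and of
    -- the rest; the truncated double sum is re-summed by the power used for the first segment.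
    have hsum : ∑ m ∈ Finset.range (q + 1),
          s ^ m • chainPoly D x₀ ((g, x) :: l) m f (chainEnd x₀ ((g, x) :: l) * s) =
        ∑ i ∈ Finset.range (q + 1), c i • ∑ j ∈ Finset.range (q - i + 1),
          s ^ j • chainPoly D x l j ((D g ^ i) f) (chainEnd x l * s) := by
      have key := Finset.sum_range_diag_flip (q + 1) fun i j =>
        c i • s ^ j • chainPoly D x l j ((D g ^ i) f) (chainEnd x l * s)
      calc _ = ∑ m ∈ Finset.range (q + 1), ∑ k ∈ Finset.range (m + 1),
            c k • s ^ (m - k) • chainPoly D x l (m - k) ((D g ^ k) f) (chainEnd x l * s) := by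
            refine Finset.sum_congr rfl fun m _ => ?_
            rw [chainPoly, Finset.Nat.sum_antidiagonal_eq_sum_range_succ_mk]
            simp only [LinearMap.sum_apply, Finset.sum_apply, LinearMap.smul_apply, Pi.smul_apply,
              Module.End.mul_apply, Finset.smul_sum, chainEnd]
            refine Finset.sum_congr rfl fun k hk => ?_
            rw [Finset.mem_range] at hk
            rw [smul_smul, smul_smul]
            congr 1
            simp only [hc]
            rw [← sub_mul, mul_pow, ← pow_sub_mul_pow s (show k ≤ m by omega)]
            ring
        _ = _ := by
            rw [key]
            refine Finset.sum_congr rfl fun i hi => ?_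
            rw [Finset.mem_range] at hi
            rw [Finset.smul_sum, show q + 1 - i = q - i + 1 by omega]
    have hI : ∫ y in 0..s, sortedNorm D (((g, x) :: l).map Prod.fst) (q + 1) f y =
        (∫ y in 0..s, ‖(D g ^ (q + 1)) f y‖) + ∑ j ∈ Finset.range (q + 1),
          ∫ y in 0..s, sortedNorm D (l.map Prod.fst) (q - j + 1) ((D g ^ j) f) y := by
      have hcont : ∀ j ∈ Finset.range (q + 1),
          Continuous (sortedNorm D (l.map Prod.fst) (q - j + 1) ((D g ^ j) f)) := by
        intro j hj
        rw [Finset.mem_range] at hj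
        exact continuous_sortedNorm h _ (by omega) (hreg j (by omega))
      rw [← intervalIntegral.integral_finsetSum
        fun j hj => (hcont j hj).intervalIntegrable _ _, ← intervalIntegral.integral_add
        (hDc.norm.intervalIntegrable _ _)
        ((continuous_finsetSum _ hcont).intervalIntegrable _ _)]
      congr 1
      ext y
      rw [List.map_cons, sortedNorm_cons_eq_sum]
      congr 1
      refine Finset.sum_congr rfl fun j hj => ?_
      rw [Finset.mem_range] at hj
      rw [show q + 1 - j = q - j + 1 by omega]
    rw [hsum, hI, mul_add, Finset.mul_sum]
    set T : X := ∑ j ∈ Finset.range (q + 1), c j • (D g ^ j) f (x * s) with hT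
    -- The Taylor remainder of the first segment is carried contractively through the rest of the
    -- path. The `i`-th Taylor term is expanded along the rest only to order `q - i`, since its
    -- coefficient already has size `s ^ i`.
    have hsplit : chainVal Φ s x₀ ((g, x) :: l) (f (x₀ * s)) -
        ∑ i ∈ Finset.range (q + 1), c i • ∑ j ∈ Finset.range (q - i + 1),
          s ^ j • chainPoly D x l j ((D g ^ i) f) (chainEnd x l * s) =
        chainVal Φ s x l (Φ g (x * s) (x₀ * s) (f (x₀ * s)) - T) +
        ∑ i ∈ Finset.range (q + 1), c i • (chainVal Φ s x l ((D g ^ i) f (x * s)) -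
          ∑ j ∈ Finset.range (q - i + 1),
            s ^ j • chainPoly D x l j ((D g ^ i) f) (chainEnd x l * s)) := by
      rw [map_sub, hT, map_sum]
      simp only [map_smul, smul_sub, Finset.sum_sub_distrib, chainVal, LinearMap.comp_apply]
      abel
    rw [hsplit]
    refine (norm_add_le _ _).trans (add_le_add ?_ ?_)
    · refine (norm_chainVal_le (fun g => (h g).norm_le) _ _ _ _).trans (hrem.trans ?_)
      gcongr
    · refine (norm_sum_le _ _).trans (Finset.sum_le_sum fun i hi => ?_)
      rw [Finset.mem_range] at hi
      rw [norm_smul, Real.norm_eq_abs]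
      calc _ ≤ s ^ i * (s ^ (q - i) *
            ∫ y in 0..s, sortedNorm D (l.map Prod.fst) (q - i + 1) ((D g ^ i) f) y) :=
            mul_le_mul (hcs i) (ih (by omega) (hreg i (by omega)) hx hl') (norm_nonneg _)
              (by positivity)
        _ = _ := by rw [← mul_assoc, ← pow_add, show i + (q - i) = q by omega]

end

end TimeDepPF
end

/-! ### Extension from the interval, and differentiation as a linear operator on all functions -/

noncomputable section

namespace TimeDepPF

section Extension

variable {X : Type*} [NormedAddCommGroup X] [NormedSpace ℝ X]

/-- A continuous function is extended by its boundary values; a smoother one by integrating an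
extension of its derivative. -/
theorem exists_contDiff_eqOn_Icc [CompleteSpace X] {t : ℝ} (ht : 0 < t) (n : ℕ) {f : ℝ → X}
    (hf : ContDiffOn ℝ n f (Icc 0 t)) : ∃ g : ℝ → X, ContDiff ℝ n g ∧ EqOn f g (Icc 0 t) := by
  induction n generalizing f with
  | zero =>
    refine ⟨IccExtend ht.le ((Icc 0 t).domRestrict f), ?_, fun x hx => ?_⟩
    · exact contDiff_zero.2 hf.continuousOn.domRestrict.Icc_extend'
    · rw [IccExtend_of_mem _ _ hx]; rfl
  | succ n ih =>
    have hu : UniqueDiffOn ℝ (Icc 0 t) := uniqueDiffOn_Icc ht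
    obtain ⟨g, hg, hfg⟩ := ih (hf.derivWithin hu (m := n) (by push_cast; rfl))
    have hd : ∀ x, HasDerivAt (fun y => f 0 + ∫ z in (0 : ℝ)..y, g z) (g x) x := fun x =>
      (intervalIntegral.integral_hasDerivAt_right (hg.continuous.intervalIntegrable _ _)
        (hg.continuous.stronglyMeasurableAtFilter _ _) hg.continuous.continuousAt).const_add _
    refine ⟨fun y => f 0 + ∫ z in (0 : ℝ)..y, g z, ?_, ?_⟩
    · push_cast
      rw [contDiff_succ_iff_deriv]
      refine ⟨fun x => (hd x).differentiableAt, by simp, ?_⟩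
      rwa [funext fun x => (hd x).deriv]
    · intro x hx
      have hdf : ∀ y ∈ Icc 0 t, HasDerivWithinAt f (g y) (Icc 0 t) y := fun y hy => by
        rw [← hfg hy]
        exact (hf.differentiableOn (by simp) y hy).hasDerivWithinAt
      have := intervalIntegral.integral_eq_sub_of_hasDerivAt_of_le hx.1
        (f := f) (f' := g) (hf.continuousOn.mono (Icc_subset_Icc_right hx.2))
        (fun y hy => (hdf y ⟨hy.1.le, hy.2.le.trans hx.2⟩).hasDerivAt
          (Icc_mem_nhds hy.1 (hy.2.trans_le hx.2))) (hg.continuous.intervalIntegrable _ _)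
      simp [this]

section Deriv

variable (X : Type*) [NormedAddCommGroup X] [NormedSpace ℝ X] [NormedSpace ℂ X]
  [IsScalarTower ℝ ℂ X]

/-- The differentiable functions of a real variable. -/
def differentiableSubmodule : Submodule ℂ (ℝ → X) where
  carrier := {f | Differentiable ℝ f}
  add_mem' hf hg := Differentiable.add hf hg
  zero_mem' := differentiable_const 0
  smul_mem' c _ hf := Differentiable.const_smul hf c

/-- A linear map on a subspace extends to the whole space. An everywhere defined operator is wanted
so that identities between polynomials in the generators can be read in an endomorphism algebra;
complex linearity lets it commute with `i`. -/
theorem exists_end_eq_deriv :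
    ∃ d : Module.End ℂ (ℝ → X), ∀ f, Differentiable ℝ f → d f = deriv f := by
  let d₀ : differentiableSubmodule X →ₗ[ℂ] (ℝ → X) :=
    { toFun := fun f => deriv f.1
      map_add' := fun f g => funext fun x => deriv_add (f.2 x) (g.2 x)
      map_smul' := fun c f => funext fun x => deriv_const_smul c (f.2 x) }
  obtain ⟨d, hd⟩ := LinearMap.exists_extend d₀
  exact ⟨d, fun f hf => LinearMap.congr_fun hd (⟨f, hf⟩ : differentiableSubmodule X)⟩

/-- A complex-linear operator on all functions that is the derivative on the differentiable ones,
as a real-linear map. -/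
def derivEnd : Module.End ℝ (ℝ → X) :=
  LinearMap.restrictScalars ℝ (exists_end_eq_deriv X).choose

variable {X}

theorem derivEnd_apply {f : ℝ → X} (hf : Differentiable ℝ f) : derivEnd X f = deriv f :=
  (exists_end_eq_deriv X).choose_spec f hf

theorem derivEnd_smul (c : ℂ) (f : ℝ → X) : derivEnd X (c • f) = c • derivEnd X f :=
  map_smul (exists_end_eq_deriv X).choose c f

theorem contDiff_derivEnd {m : ℕ} {f : ℝ → X} (hf : ContDiff ℝ (m + 1 : ℕ) f) :
    ContDiff ℝ m (derivEnd X f) := by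
  rw [derivEnd_apply (hf.differentiable (by simp))]
  exact (contDiff_succ_iff_deriv.1 (by exact_mod_cast hf)).2.2

end Deriv

end Extension

/-! ### The Dyson series and its differential equation -/

section Evolution

variable {E : Type*} [NormedAddCommGroup E] [InnerProductSpace ℂ E]

theorem dysonTerm_congr {H H' : ℝ → E →L[ℂ] E} {t : ℝ} (h : EqOn H H' (Icc 0 t)) {s₀ s : ℝ}
    (hs₀ : s₀ ∈ Icc 0 t) (hs : s ∈ Icc 0 t) (n : ℕ) :
    dysonTerm H s₀ n s = dysonTerm H' s₀ n s := by
  induction n generalizing s with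
  | zero => rfl
  | succ n ih =>
    simp only [dysonTerm]
    congr 1
    refine intervalIntegral.integral_congr fun x hx => ?_
    have hx' : x ∈ Icc 0 t := uIcc_subset_Icc hs₀ hs hx
    simp only [h hx', ih hx']

theorem timeEvolution_congr {H H' : ℝ → E →L[ℂ] E} {t : ℝ} (h : EqOn H H' (Icc 0 t)) {s₀ s : ℝ}
    (hs₀ : s₀ ∈ Icc 0 t) (hs : s ∈ Icc 0 t) :
    timeEvolution H s s₀ = timeEvolution H' s s₀ :=
  tsum_congr fun n => dysonTerm_congr h hs₀ hs n

theorem timeEvolution_self (H : ℝ → E →L[ℂ] E) (s : ℝ) : timeEvolution H s s = 1 := by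
  rw [timeEvolution, tsum_eq_single 0]
  · rfl
  · intro n hn
    obtain ⟨m, rfl⟩ := Nat.exists_eq_succ_of_ne_zero hn
    simp [dysonTerm]

/-- The iterated integrals over an ordered simplex produce the factorial, which makes the series and
its termwise derivative converge locally uniformly. -/
theorem norm_dysonTerm_le {H : ℝ → E →L[ℂ] E} (s₀ R C : ℝ)
    (hC : ∀ x, |x - s₀| ≤ R → ‖H x‖ ≤ C) (n : ℕ) (s : ℝ) (hs : |s - s₀| ≤ R) :
    ‖dysonTerm H s₀ n s‖ ≤ (C * |s - s₀|) ^ n / n.factorial := by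
  have hC0 : 0 ≤ C := (norm_nonneg _).trans (hC s hs)
  induction n generalizing s with
  | zero => simpa [dysonTerm] using! (ContinuousLinearMap.norm_id_le : ‖ContinuousLinearMap.id ℂ E‖ ≤ 1)
  | succ n ih =>
    rw [dysonTerm, norm_smul, norm_neg, Complex.norm_I, one_mul]
    have hx : ∀ x ∈ Set.uIoc s₀ s, |x - s₀| ≤ R := fun x hx => by
      refine le_trans ?_ hs
      have := uIoc_subset_uIcc hx
      rw [mem_uIcc] at this
      rcases this with h | h
      · rw [abs_of_nonneg (by linarith), abs_of_nonneg (by linarith)]; linarith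
      · rw [abs_of_nonpos (by linarith), abs_of_nonpos (by linarith)]; linarith
    have h1 : ∀ x ∈ Set.uIoc s₀ s, ‖H x * dysonTerm H s₀ n x‖
        ≤ C ^ (n + 1) / n.factorial * |x - s₀| ^ n := by
      intro x hxs
      refine (norm_mul_le _ _).trans ((mul_le_mul (hC x (hx x hxs)) (ih x (hx x hxs))
        (norm_nonneg _) hC0).trans (le_of_eq ?_))
      ring
    refine intervalIntegral.norm_integral_le_integral_norm_uIoc.trans ?_
    refine (MeasureTheory.integral_mono_of_nonneg (Eventually.of_forall fun _ => norm_nonneg _)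
      (g := fun x => C ^ (n + 1) / n.factorial * |x - s₀| ^ n) ?_ ?_).trans (le_of_eq ?_)
    · exact Continuous.integrableOn_uIoc (by fun_prop)
    · exact (MeasureTheory.ae_restrict_iff' measurableSet_uIoc).2 (Eventually.of_forall h1)
    · rw [MeasureTheory.integral_const_mul, integral_pow_abs_sub_uIoc, Nat.factorial_succ]
      push_cast
      field_simp
      ring

variable [CompleteSpace E]

theorem hasDerivAt_dysonTerm_succ {H : ℝ → E →L[ℂ] E} (hH : Continuous H) (s₀ : ℝ) (n : ℕ)
    (s : ℝ) (hc : Continuous (dysonTerm H s₀ n)) :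
    HasDerivAt (dysonTerm H s₀ (n + 1)) (-Complex.I • (H s * dysonTerm H s₀ n s)) s := by
  have hc' := hH.mul hc
  exact (intervalIntegral.integral_hasDerivAt_right (hc'.intervalIntegrable _ _)
        (hc'.stronglyMeasurableAtFilter _ _) hc'.continuousAt).const_smul (-Complex.I)

theorem continuous_dysonTerm {H : ℝ → E →L[ℂ] E} (hH : Continuous H) (s₀ : ℝ) (n : ℕ) :
    Continuous (dysonTerm H s₀ n) := by
  induction n with
  | zero => exact continuous_const
  | succ n ih =>
    exact continuous_iff_continuousAt.2 fun s =>
      (hasDerivAt_dysonTerm_succ hH s₀ n s ih).continuousAt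

theorem hasDerivAt_timeEvolution {H : ℝ → E →L[ℂ] E} (hH : Continuous H) (s₀ s : ℝ) :
    HasDerivAt (fun s => timeEvolution H s s₀) (-Complex.I • (H s * timeEvolution H s s₀)) s := by
  set R := |s - s₀| + 1 with hR
  obtain ⟨C, hC⟩ := (isCompact_Icc (a := s₀ - R) (b := s₀ + R)).exists_bound_of_continuousOn
    hH.continuousOn
  have hC' : ∀ x, |x - s₀| ≤ R → ‖H x‖ ≤ C := fun x hx => by
    rw [abs_le] at hx
    exact hC x ⟨by linarith, by linarith⟩
  have hR0 : 0 < R := by positivity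
  have hC0 : 0 ≤ C := (norm_nonneg _).trans (hC' s₀ (by simpa using hR0.le))
  have hball : ∀ x ∈ Ioo (s₀ - R) (s₀ + R), |x - s₀| ≤ R := fun x hx =>
    abs_le.2 ⟨by linarith [hx.1], by linarith [hx.2]⟩
  have hs : s ∈ Ioo (s₀ - R) (s₀ + R) := by
    have := abs_lt.1 (show |s - s₀| < R by linarith)
    constructor <;> linarith [this.1, this.2]
  have hbd : ∀ n, ∀ y ∈ Ioo (s₀ - R) (s₀ + R), ‖dysonTerm H s₀ n y‖ ≤ (C * R) ^ n / n.factorial :=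
    fun n y hy => (norm_dysonTerm_le s₀ R C hC' n y (hball y hy)).trans (by
      gcongr; exact hball y hy)
  have hsum : Summable fun n : ℕ => (C * R) ^ n / (n.factorial : ℝ) :=
    Real.summable_pow_div_factorial _
  have hsumD : Summable fun n => dysonTerm H s₀ n s :=
    Summable.of_norm_bounded hsum fun n => hbd n s hs
  have hsumD' : ∀ y ∈ Ioo (s₀ - R) (s₀ + R), Summable fun n => dysonTerm H s₀ n y := fun y hy =>
    Summable.of_norm_bounded hsum fun n => hbd n y hy
  have hder : ∀ n, ∀ y ∈ Ioo (s₀ - R) (s₀ + R), HasDerivAt (dysonTerm H s₀ (n + 1))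
      (-Complex.I • (H y * dysonTerm H s₀ n y)) y := fun n y _ =>
    hasDerivAt_dysonTerm_succ hH s₀ n y (continuous_dysonTerm hH s₀ n)
  have hderbd : ∀ n, ∀ y ∈ Ioo (s₀ - R) (s₀ + R),
      ‖-Complex.I • (H y * dysonTerm H s₀ n y)‖ ≤ C * ((C * R) ^ n / n.factorial) := by
    intro n y hy
    rw [norm_smul, norm_neg, Complex.norm_I, one_mul]
    exact (norm_mul_le _ _).trans
      (mul_le_mul (hC' y (hball y hy)) (hbd n y hy) (norm_nonneg _) hC0)
  have hsum1 : Summable fun n => dysonTerm H s₀ (n + 1) s :=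
    (summable_nat_add_iff 1 (f := fun n => dysonTerm H s₀ n s)).2 hsumD
  have key : HasDerivAt (fun y => ∑' n, dysonTerm H s₀ (n + 1) y)
      (∑' n, -Complex.I • (H s * dysonTerm H s₀ n s)) s :=
    hasDerivAt_tsum_of_isPreconnected (hsum.mul_left C) isOpen_Ioo isPreconnected_Ioo
      hder hderbd hs hsum1 hs
  have hs' : ∑' n, -Complex.I • (H s * dysonTerm H s₀ n s) =
      -Complex.I • (H s * timeEvolution H s s₀) :=
    ((hsumD.hasSum.mul_left (H s)).const_smul (-Complex.I)).tsum_eq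
  rw [hs'] at key
  have heq : ∀ y ∈ Ioo (s₀ - R) (s₀ + R), timeEvolution H y s₀ =
      1 + ∑' n, dysonTerm H s₀ (n + 1) y := fun y hy => by
    rw [timeEvolution, (hsumD' y hy).tsum_eq_zero_add]
    rfl
  exact (key.const_add 1).congr_of_eventuallyEq
    (Filter.eventually_of_mem (isOpen_Ioo.mem_nhds hs) heq)

end Evolution

end TimeDepPF
end

/-! ### Unitarity of the evolution and the two propagators built from it -/

noncomputable section

namespace TimeDepPF

section Unitary

variable {E : Type*} [NormedAddCommGroup E] [InnerProductSpace ℂ E] [CompleteSpace E]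
  {H : ℝ → E →L[ℂ] E}

/-- For self-adjoint `H` the derivatives of the two factors cancel, so the product is constant.
Isometry, uniqueness of solutions and the composition law all come from this. -/
theorem star_timeEvolution_mul_of_hasDerivAt (hH : Continuous H) (hsa : ∀ x, IsSelfAdjoint (H x))
    (s₀ : ℝ) {Y : ℝ → E →L[ℂ] E}
    (hY : ∀ s, HasDerivAt Y (-Complex.I • (H s * Y s)) s) (s : ℝ) :
    star (timeEvolution H s s₀) * Y s = Y s₀ := by
  have hd : ∀ x, HasDerivAt (fun x => star (timeEvolution H x s₀) * Y x) 0 x := by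
    intro x
    refine ((hasDerivAt_timeEvolution hH s₀ x).star.mul (hY x)).congr_deriv ?_
    rw [star_smul, star_mul, (hsa x).star_eq]
    simp [mul_assoc]
  have := is_const_of_deriv_eq_zero (fun x => (hd x).differentiableAt) (fun x => (hd x).deriv) s s₀
  simpa [timeEvolution_self] using this

theorem star_timeEvolution_mul_self (hH : Continuous H) (hsa : ∀ x, IsSelfAdjoint (H x))
    (s s₀ : ℝ) : star (timeEvolution H s s₀) * timeEvolution H s s₀ = 1 := by
  rw [star_timeEvolution_mul_of_hasDerivAt hH hsa s₀ (hasDerivAt_timeEvolution hH s₀),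
    timeEvolution_self]

theorem norm_timeEvolution_le (hH : Continuous H) (hsa : ∀ x, IsSelfAdjoint (H x))
    (s s₀ : ℝ) : ‖timeEvolution H s s₀‖ ≤ 1 := by
  have h1 : ‖timeEvolution H s s₀‖ * ‖timeEvolution H s s₀‖ ≤ 1 := by
    rw [← CStarRing.norm_star_mul_self, star_timeEvolution_mul_self hH hsa]
    exact (ContinuousLinearMap.norm_id_le : ‖ContinuousLinearMap.id ℂ E‖ ≤ 1)
  nlinarith [norm_nonneg (timeEvolution H s s₀)]

variable [FiniteDimensional ℂ E]

/-- In finite dimension a left inverse is a right inverse. -/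
theorem timeEvolution_mul_star_self (hH : Continuous H) (hsa : ∀ x, IsSelfAdjoint (H x))
    (s s₀ : ℝ) : timeEvolution H s s₀ * star (timeEvolution H s s₀) = 1 := by
  have h := star_timeEvolution_mul_self hH hsa s s₀
  have h' : ((star (timeEvolution H s s₀) : E →L[ℂ] E) : E →ₗ[ℂ] E) *
      (timeEvolution H s s₀ : E →ₗ[ℂ] E) = 1 := by
    ext v
    exact congrArg (fun A : E →L[ℂ] E => A v) h
  rw [mul_eq_one_comm] at h'
  ext v
  exact LinearMap.congr_fun h' v

theorem eq_timeEvolution_mul_of_hasDerivAt (hH : Continuous H) (hsa : ∀ x, IsSelfAdjoint (H x))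
    (s₀ : ℝ) {Y : ℝ → E →L[ℂ] E}
    (hY : ∀ s, HasDerivAt Y (-Complex.I • (H s * Y s)) s) (s : ℝ) :
    Y s = timeEvolution H s s₀ * Y s₀ := by
  rw [← star_timeEvolution_mul_of_hasDerivAt hH hsa s₀ hY s, ← mul_assoc,
    timeEvolution_mul_star_self hH hsa, one_mul]

theorem timeEvolution_mul_timeEvolution (hH : Continuous H) (hsa : ∀ x, IsSelfAdjoint (H x))
    (s r s₀ : ℝ) : timeEvolution H s r * timeEvolution H r s₀ = timeEvolution H s s₀ :=
  (eq_timeEvolution_mul_of_hasDerivAt hH hsa r (hasDerivAt_timeEvolution hH s₀) s).symm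

theorem star_timeEvolution (hH : Continuous H) (hsa : ∀ x, IsSelfAdjoint (H x))
    (s s₀ : ℝ) : star (timeEvolution H s s₀) = timeEvolution H s₀ s := by
  have h := timeEvolution_mul_timeEvolution hH hsa s s₀ s
  rw [timeEvolution_self] at h
  calc star (timeEvolution H s s₀)
      = star (timeEvolution H s s₀) * (timeEvolution H s s₀ * timeEvolution H s₀ s) := by
        rw [h, mul_one]
    _ = timeEvolution H s₀ s := by
        rw [← mul_assoc, star_timeEvolution_mul_self hH hsa, one_mul]

theorem hasDerivAt_timeEvolution_right (hH : Continuous H) (hsa : ∀ x, IsSelfAdjoint (H x))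
    (b x : ℝ) : HasDerivAt (fun x => timeEvolution H b x)
      (Complex.I • (timeEvolution H b x * H x)) x := by
  have h := (hasDerivAt_timeEvolution hH b x).star
  rw [star_smul, star_mul, (hsa x).star_eq, star_timeEvolution hH hsa] at h
  simp only [star_timeEvolution hH hsa] at h
  simpa using h

theorem timeEvolution_const {A : E →L[ℂ] E} (hA : IsSelfAdjoint A) (s s₀ : ℝ) :
    timeEvolution (fun _ => A) s s₀ =
      NormedSpace.exp ((-Complex.I * ((s - s₀ : ℝ) : ℂ)) • A) := by
  have hd : ∀ s : ℝ, HasDerivAt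
      (fun s : ℝ => NormedSpace.exp ((-Complex.I * ((s - s₀ : ℝ) : ℂ)) • A))
      (-Complex.I • (A * NormedSpace.exp ((-Complex.I * ((s - s₀ : ℝ) : ℂ)) • A))) s := by
    intro s
    have h1 : HasDerivAt (fun s : ℝ => -Complex.I * ((s - s₀ : ℝ) : ℂ)) (-Complex.I) s := by
      have := (((hasDerivAt_id s).sub_const s₀).ofReal_comp).const_mul (-Complex.I)
      simpa using this
    exact (hasDerivAt_exp_smul_const' A (-Complex.I * ((s - s₀ : ℝ) : ℂ))).scomp s h1
  have := eq_timeEvolution_mul_of_hasDerivAt continuous_const (fun _ => hA) s₀ hd s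
  simpa using this.symm

end Unitary

section Propagators

variable {E : Type*} [NormedAddCommGroup E] [InnerProductSpace ℂ E]

/-- Pointwise multiplication by `i H` from the left. -/
def mulOp (H : ℝ → E →L[ℂ] E) : Module.End ℝ (ℝ → E →L[ℂ] E) where
  toFun f := fun x => Complex.I • (H x * f x)
  map_add' f g := by ext1 x; simp [mul_add]
  map_smul' c f := by ext1 x; simp [smul_comm c Complex.I]

/-- The pointwise commutator with `H`. -/
def adOp (H : ℝ → E →L[ℂ] E) : Module.End ℝ (ℝ → E →L[ℂ] E) where
  toFun f := fun x => H x * f x - f x * H x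
  map_add' f g := by ext1 x; simp [mul_add, add_mul]; abel
  map_smul' c f := by ext1 x; simp [smul_sub]

/-- Multiplication by the imaginary unit. -/
def mulI : Module.End ℝ (ℝ → E →L[ℂ] E) where
  toFun f := fun x => Complex.I • f x
  map_add' f g := by ext1 x; simp
  map_smul' c f := by ext1 x; simp [smul_comm c Complex.I]

/-- The generator `d/dx + i H` of the evolution of operators by multiplication from the left. -/
def leftGen (H : ℝ → E →L[ℂ] E) : Module.End ℝ (ℝ → E →L[ℂ] E) := derivEnd _ + mulOp H

/-- The generator `d/dx + i ad_H` of the evolution of operators by conjugation. -/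
def adGen (H : ℝ → E →L[ℂ] E) : Module.End ℝ (ℝ → E →L[ℂ] E) := derivEnd _ + mulI * adOp H

/-- Multiplication by the time evolution from the left. -/
def leftProp (H : ℝ → E →L[ℂ] E) (b a : ℝ) : (E →L[ℂ] E) →ₗ[ℝ] (E →L[ℂ] E) :=
  LinearMap.mulLeft ℝ (timeEvolution H b a)

/-- Conjugation by the time evolution. -/
def adProp (H : ℝ → E →L[ℂ] E) (b a : ℝ) : (E →L[ℂ] E) →ₗ[ℝ] (E →L[ℂ] E) :=
  LinearMap.mulLeft ℝ (timeEvolution H b a) ∘ₗ LinearMap.mulRight ℝ (timeEvolution H a b)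

theorem contDiff_adOp {H f : ℝ → E →L[ℂ] E} {m : ℕ} (hH : ContDiff ℝ m H) (hf : ContDiff ℝ m f) :
    ContDiff ℝ m (adOp H f) :=
  (hH.mul hf).sub (hf.mul hH)

variable [CompleteSpace E] [FiniteDimensional ℂ E] {H : ℝ → E →L[ℂ] E} {n : ℕ}

/-- This propagator expands `U` and `S` themselves and serves the order condition. -/
theorem isPropagator_left (hH : ContDiff ℝ n H) (hsa : ∀ x, IsSelfAdjoint (H x)) :
    IsPropagator (leftProp H) (leftGen H) n where
  refl b v := by simp [leftProp, timeEvolution_self]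
  norm_le b a v := by
    refine (norm_mul_le _ _).trans ?_
    exact mul_le_of_le_one_left (norm_nonneg _) (norm_timeEvolution_le hH.continuous hsa b a)
  hasDerivAt f hf b x := by
    refine ((hasDerivAt_timeEvolution_right hH.continuous hsa b x).mul
      (hf x).hasDerivAt).congr_deriv ?_
    simp only [leftProp, leftGen, LinearMap.add_apply, Pi.add_apply, derivEnd_apply hf, mulOp,
      LinearMap.coe_mk, AddHom.coe_mk, LinearMap.mulLeft_apply]
    rw [mul_add, smul_mul_assoc, mul_smul_comm, mul_assoc, add_comm]
  continuous f hf b :=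
    (continuous_iff_continuousAt.2 fun x =>
      (hasDerivAt_timeEvolution_right hH.continuous hsa b x).continuousAt).mul hf
  contDiff m hm f hf := by
    refine (contDiff_derivEnd hf).add (ContDiff.const_smul Complex.I ?_)
    exact (hH.of_le (by exact_mod_cast hm)).mul (hf.of_le (by exact_mod_cast Nat.le_succ m))

/-- This propagator expands the conjugated Hamiltonians in `factorGen`; its generator is the source
of the nested commutators. -/
theorem isPropagator_ad (hH : ContDiff ℝ n H) (hsa : ∀ x, IsSelfAdjoint (H x)) :
    IsPropagator (adProp H) (adGen H) n where
  refl b v := by simp [adProp, timeEvolution_self]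
  norm_le b a v := by
    refine (norm_mul_le _ _).trans ?_
    refine (mul_le_of_le_one_left (norm_nonneg _)
      (norm_timeEvolution_le hH.continuous hsa b a)).trans ?_
    refine (norm_mul_le _ _).trans ?_
    exact mul_le_of_le_one_right (norm_nonneg _) (norm_timeEvolution_le hH.continuous hsa a b)
  hasDerivAt f hf b x := by
    refine ((hasDerivAt_timeEvolution_right hH.continuous hsa b x).mul
      ((hf x).hasDerivAt.mul (hasDerivAt_timeEvolution hH.continuous b x))).congr_deriv ?_
    simp only [adProp, adGen, LinearMap.add_apply, Pi.add_apply, derivEnd_apply hf, adOp, mulI,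
      LinearMap.coe_mk, AddHom.coe_mk, LinearMap.mulLeft_apply, LinearMap.mulRight_apply,
      LinearMap.comp_apply, Module.End.mul_apply]
    simp only [mul_add, add_mul, smul_mul_assoc, mul_smul_comm, mul_assoc, smul_sub, sub_mul,
      mul_sub, neg_smul, mul_neg, Pi.mul_apply]
    abel
  continuous f hf b :=
    (continuous_iff_continuousAt.2 fun x =>
      (hasDerivAt_timeEvolution_right hH.continuous hsa b x).continuousAt).mul
      (hf.mul (continuous_iff_continuousAt.2 fun x =>
        (hasDerivAt_timeEvolution hH.continuous b x).continuousAt))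
  contDiff m hm f hf := by
    refine (contDiff_derivEnd hf).add (ContDiff.const_smul Complex.I ?_)
    exact contDiff_adOp (hH.of_le (by exact_mod_cast hm))
      (hf.of_le (by exact_mod_cast Nat.le_succ m))

end Propagators

end TimeDepPF
end

/-! ### Product formulas as transports along paths -/

noncomputable section

namespace TimeDepPF

section Paths

variable {Γ : ℕ}

/-- The first start time in a list of factors `(γ, a, b)`, and `z` for the empty list. -/
def nextStart (z : ℝ) : List (Fin Γ × ℝ × ℝ) → ℝ
  | [] => z
  | x :: _ => x.2.1

theorem nextStart_cons (z : ℝ) (x : Fin Γ × ℝ × ℝ) (L : List (Fin Γ × ℝ × ℝ)) :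
    nextStart z (x :: L) = x.2.1 := rfl

/-- The path through the factors `(γ, a, b)`: evolution under the term `γ` from `a` to `b`, then a
shift (letter `none`) to the start of the next factor, in the end to `z`. -/
def factorPath (z : ℝ) : List (Fin Γ × ℝ × ℝ) → List (Option (Fin Γ) × ℝ)
  | [] => []
  | x :: L => (some x.1, x.2.2) :: (none, nextStart z L) :: factorPath z L

/-- The end point fixes where Taylor coefficients are evaluated: `z = 0` makes those of `factorGen`
constants, and `z = 1` puts those of `S` at time `s`, where those of `U` also sit. -/
theorem chainEnd_factorPath (z : ℝ) (L : List (Fin Γ × ℝ × ℝ)) :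
    chainEnd (nextStart z L) (factorPath z L) = z := by
  induction L with
  | nil => rfl
  | cons x L ih => simpa [factorPath, chainEnd, nextStart] using ih

theorem nextStart_mem {z : ℝ} (hz : z ∈ Icc (0 : ℝ) 1) {L : List (Fin Γ × ℝ × ℝ)}
    (hL : ∀ x ∈ L, x.2.1 ∈ Icc (0 : ℝ) 1) : nextStart z L ∈ Icc (0 : ℝ) 1 := by
  cases L with
  | nil => exact hz
  | cons x L => exact hL x (by simp)

theorem factorPath_mem {z : ℝ} (hz : z ∈ Icc (0 : ℝ) 1) {L : List (Fin Γ × ℝ × ℝ)}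
    (hL : ∀ x ∈ L, x.2.1 ∈ Icc (0 : ℝ) 1 ∧ x.2.2 ∈ Icc (0 : ℝ) 1) :
    ∀ y ∈ factorPath z L, y.2 ∈ Icc (0 : ℝ) 1 := by
  induction L with
  | nil => simp [factorPath]
  | cons x L ih =>
    have hL' : ∀ x ∈ L, x.2.1 ∈ Icc (0 : ℝ) 1 ∧ x.2.2 ∈ Icc (0 : ℝ) 1 :=
      fun y hy => hL y (by simp [hy])
    intro y hy
    rw [factorPath, List.mem_cons, List.mem_cons] at hy
    rcases hy with rfl | rfl | hy
    · exact (hL x (by simp)).2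
    · exact nextStart_mem hz fun y hy => (hL' y hy).1
    · exact ih hL' y hy

/-- The factors `(γ k, β k, β k + α k)` of a product formula. -/
def ProductFormula.factors {K : ℕ} (F : ProductFormula Γ K) : List (Fin Γ × ℝ × ℝ) :=
  List.ofFn fun k => (F.γ k, F.β k, F.β k + F.α k)

theorem ProductFormula.mem_factors {K : ℕ} (F : ProductFormula Γ K) {x : Fin Γ × ℝ × ℝ}
    (hx : x ∈ F.factors) : x.2.1 ∈ Icc (0 : ℝ) 1 ∧ x.2.2 ∈ Icc (0 : ℝ) 1 := by
  rw [ProductFormula.factors, List.mem_ofFn] at hx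
  obtain ⟨k, rfl⟩ := hx
  exact ⟨F.β_mem k, F.β_add_α_mem k⟩

theorem ProductFormula.nextStart_factors {K : ℕ} (F : ProductFormula Γ K) (z : ℝ) :
    nextStart z F.factors = 0 := by
  obtain ⟨K, rfl⟩ : ∃ K', K = K' + 1 := ⟨K - 1, by have := F.K_pos; omega⟩
  rw [ProductFormula.factors, List.ofFn_succ]
  exact F.β_first

end Paths

section Products

variable {E : Type*} [NormedAddCommGroup E] [InnerProductSpace ℂ E] {Γ : ℕ}

/-- The Hamiltonians indexed by letters: `H₀` for `none` and `H g` for `some g`. -/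
def letterHam (H₀ : ℝ → E →L[ℂ] E) (H : Fin Γ → ℝ → E →L[ℂ] E) : Option (Fin Γ) → ℝ → E →L[ℂ] E
  | none => H₀
  | some g => H g

theorem letterHam_none (H₀ : ℝ → E →L[ℂ] E) (H : Fin Γ → ℝ → E →L[ℂ] E) :
    letterHam H₀ H none = H₀ := rfl

theorem letterHam_some (H₀ : ℝ → E →L[ℂ] E) (H : Fin Γ → ℝ → E →L[ℂ] E) (g : Fin Γ) :
    letterHam H₀ H (some g) = H g := rfl

/-- The time-ordered product of the evolutions along the path of a list of factors. -/
def pathProd (H : Option (Fin Γ) → ℝ → E →L[ℂ] E) (z s : ℝ) : List (Fin Γ × ℝ × ℝ) → E →L[ℂ] E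
  | [] => 1
  | x :: L => pathProd H z s L * (timeEvolution (H none) (nextStart z L * s) (x.2.2 * s) *
      timeEvolution (H (some x.1)) (x.2.2 * s) (x.2.1 * s))

/-- The product of the evolutions of a list of factors. -/
def factorProd (H : Fin Γ → ℝ → E →L[ℂ] E) (s : ℝ) : List (Fin Γ × ℝ × ℝ) → E →L[ℂ] E
  | [] => 1
  | x :: L => factorProd H s L * timeEvolution (H x.1) (x.2.2 * s) (x.2.1 * s)

theorem ProductFormula.S_eq_factorProd {K : ℕ} (F : ProductFormula Γ K)
    (H : Fin Γ → ℝ → E →L[ℂ] E) (s : ℝ) : F.S H s = factorProd H s F.factors := by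
  have h : ∀ L : List (Fin Γ × ℝ × ℝ), factorProd H s L =
      (L.map fun x => timeEvolution (H x.1) (x.2.2 * s) (x.2.1 * s)).reverse.prod := by
    intro L
    induction L with
    | nil => rfl
    | cons x L ih => simp [factorProd, ih]
  rw [h, ProductFormula.factors, List.map_ofFn, ProductFormula.S]
  simp only [Function.comp_def, add_mul]

theorem chainVal_left_eq (H : Option (Fin Γ) → ℝ → E →L[ℂ] E) (z s : ℝ)
    (L : List (Fin Γ × ℝ × ℝ)) (v : E →L[ℂ] E) :
    chainVal (fun o => leftProp (H o)) s (nextStart z L) (factorPath z L) v =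
      pathProd H z s L * v := by
  induction L generalizing v with
  | nil => simp [chainVal, factorPath, pathProd]
  | cons x L ih =>
    simp only [factorPath, chainVal, LinearMap.comp_apply, nextStart_cons, pathProd, ih]
    simp [leftProp, mul_assoc]

variable [CompleteSpace E] [FiniteDimensional ℂ E]

theorem timeEvolution_zero (s s₀ : ℝ) : timeEvolution (0 : ℝ → E →L[ℂ] E) s s₀ = 1 := by
  have := timeEvolution_const (E := E) (A := 0) (IsSelfAdjoint.zero _) s s₀
  simpa [Pi.zero_def] using this

theorem pathProd_eq_factorProd (H : Fin Γ → ℝ → E →L[ℂ] E) (z s : ℝ)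
    (L : List (Fin Γ × ℝ × ℝ)) : pathProd (letterHam 0 H) z s L = factorProd H s L := by
  induction L with
  | nil => rfl
  | cons x L ih => simp [pathProd, factorProd, ih, letterHam, timeEvolution_zero]

/-- The shifts have Hamiltonian `0` and act trivially on operators, so only the conjugations by the
factors remain. -/
theorem chainVal_ad_eq {H : Fin Γ → ℝ → E →L[ℂ] E} (hH : ∀ g, Continuous (H g))
    (hsa : ∀ g x, IsSelfAdjoint (H g x)) (z s : ℝ)
    (L : List (Fin Γ × ℝ × ℝ)) (v : E →L[ℂ] E) :
    chainVal (fun o => adProp (letterHam 0 H o)) s (nextStart z L) (factorPath z L) v =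
      factorProd H s L * v * star (factorProd H s L) := by
  induction L generalizing v with
  | nil => simp [chainVal, factorPath, factorProd]
  | cons x L ih =>
    simp only [factorPath, chainVal, LinearMap.comp_apply, nextStart_cons, factorProd, ih]
    simp [adProp, letterHam_none, letterHam_some, timeEvolution_zero, mul_assoc, star_timeEvolution (hH x.1) (hsa x.1)]

/-- The operator `Q` in the evolution equation `dS/ds = -i Q S` of a product of evolutions. -/
def factorGen (H : Fin Γ → ℝ → E →L[ℂ] E) (s : ℝ) : List (Fin Γ × ℝ × ℝ) → E →L[ℂ] E
  | [] => 0
  | x :: L => factorGen H s L +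
      (x.2.2 • chainVal (fun o => adProp (letterHam 0 H o)) s x.2.2
          ((none, nextStart 0 L) :: factorPath 0 L) (H x.1 (x.2.2 * s)) -
        x.2.1 • chainVal (fun o => adProp (letterHam 0 H o)) s x.2.1
          (factorPath 0 (x :: L)) (H x.1 (x.2.1 * s)))

omit [FiniteDimensional ℂ E] in
theorem star_factorProd_mul_self {H : Fin Γ → ℝ → E →L[ℂ] E} (hH : ∀ g, Continuous (H g))
    (hsa : ∀ g x, IsSelfAdjoint (H g x)) (s : ℝ) (L : List (Fin Γ × ℝ × ℝ)) :
    star (factorProd H s L) * factorProd H s L = 1 := by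
  induction L with
  | nil => simp [factorProd]
  | cons x L ih =>
    rw [factorProd, star_mul, mul_assoc, ← mul_assoc (star (factorProd H s L)), ih, one_mul,
      star_timeEvolution_mul_self (hH x.1) (hsa x.1)]

theorem hasDerivAt_timeEvolution_scaled {H : ℝ → E →L[ℂ] E} (hH : Continuous H)
    (hsa : ∀ x, IsSelfAdjoint (H x)) (b a s : ℝ) :
    HasDerivAt (fun s => timeEvolution H (b * s) (a * s))
      (-Complex.I • (b • (H (b * s) * timeEvolution H (b * s) (a * s)) -
        a • (timeEvolution H (b * s) (a * s) * H (a * s)))) s := by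
  have hlin : ∀ c : ℝ, HasDerivAt (fun s : ℝ => c * s) c s := fun c => by
    simpa using (hasDerivAt_id s).const_mul c
  have h1 := (hasDerivAt_timeEvolution hH 0 (b * s)).scomp s (hlin b)
  have h2 := (hasDerivAt_timeEvolution_right hH hsa 0 (a * s)).scomp s (hlin a)
  have h3 : HasDerivAt (((fun s => timeEvolution H s 0) ∘ fun s => b * s) *
      ((fun x => timeEvolution H 0 x) ∘ fun s => a * s))
      ((b • (-Complex.I • (H (b * s) * timeEvolution H (b * s) 0))) * timeEvolution H 0 (a * s) +
        timeEvolution H (b * s) 0 *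
          (a • (Complex.I • (timeEvolution H 0 (a * s) * H (a * s))))) s := h1.mul h2
  have heq : (fun s => timeEvolution H (b * s) (a * s)) =
      ((fun s => timeEvolution H s 0) ∘ fun s => b * s) *
        ((fun x => timeEvolution H 0 x) ∘ fun s => a * s) := by
    ext1 x
    exact (timeEvolution_mul_timeEvolution hH hsa (b * x) 0 (a * x)).symm
  rw [heq]
  refine h3.congr_deriv ?_
  rw [← timeEvolution_mul_timeEvolution hH hsa (b * s) 0 (a * s)]
  simp only [smul_mul_assoc, mul_smul_comm, mul_assoc, smul_sub, neg_smul, smul_comm Complex.I,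
    smul_neg, neg_mul]
  abel

/-- In the product rule, the Hamiltonians produced at both ends of a factor are moved to the far
left by conjugating with everything that stands there; `S† S = 1` cancels the inserted pairs. -/
theorem hasDerivAt_factorProd {H : Fin Γ → ℝ → E →L[ℂ] E} (hH : ∀ g, Continuous (H g))
    (hsa : ∀ g x, IsSelfAdjoint (H g x)) (s : ℝ) (L : List (Fin Γ × ℝ × ℝ)) :
    HasDerivAt (fun s => factorProd H s L)
      (-Complex.I • (factorGen H s L * factorProd H s L)) s := by
  induction L with
  | nil => simpa [factorProd, factorGen] using hasDerivAt_const s (1 : E →L[ℂ] E)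
  | cons x L ih =>
    refine (ih.mul (hasDerivAt_timeEvolution_scaled (hH x.1) (hsa x.1) x.2.2 x.2.1 s)).congr_deriv
      ?_
    have h1 : chainVal (fun o => adProp (letterHam 0 H o)) s x.2.2
          ((none, nextStart 0 L) :: factorPath 0 L) (H x.1 (x.2.2 * s)) =
        factorProd H s L * H x.1 (x.2.2 * s) * star (factorProd H s L) := by
      rw [← chainVal_ad_eq hH hsa 0 s L]
      simp [chainVal, adProp, letterHam_none, timeEvolution_zero]
    have h2 := chainVal_ad_eq hH hsa 0 s (x :: L) (H x.1 (x.2.1 * s))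
    simp only [nextStart] at h2
    simp only [factorGen, h1, h2]
    simp only [factorProd, add_mul, sub_mul, smul_mul_assoc, star_mul, mul_assoc]
    rw [← mul_assoc (star (factorProd H s L)), star_factorProd_mul_self hH hsa, one_mul,
      star_timeEvolution_mul_self (hH x.1) (hsa x.1), mul_one]
    simp only [mul_smul_comm, mul_sub, smul_add, smul_sub]

/-- The shift after factor `k` lasts `β (k+1) - (β k + α k)`, the negative of the time under `H₀` in
the counterpart; hence the Hamiltonian `-H₀`. With end point `1` the last shift is trivial, because
`β + α = 1` for the last factor. -/
theorem ProductFormula.T_eq_pathProd {K : ℕ} (F : ProductFormula Γ K) {H₀ : E →L[ℂ] E}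
    {H : Fin Γ → E →L[ℂ] E} (hsa₀ : IsSelfAdjoint H₀) (hsa : ∀ g, IsSelfAdjoint (H g)) (s : ℝ) :
    F.T H₀ H s = pathProd (letterHam (fun _ => -H₀) fun g _ => H g) 1 s F.factors := by
  have key : ∀ (K : ℕ) (γ : Fin K → Fin Γ) (α β : Fin K → ℝ),
      (∀ k : Fin K, (k : ℕ) + 1 = K → β k + α k = 1) →
      (List.ofFn fun k : Fin K =>
        (if h : (k : ℕ) + 1 < K then
          NormedSpace.exp ((-Complex.I * ((β k + α k - β ⟨k + 1, h⟩) * s : ℝ)) • H₀)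
        else 1) *
        NormedSpace.exp ((-Complex.I * (α k * s : ℝ)) • H (γ k))).reverse.prod =
      pathProd (letterHam (fun _ => -H₀) fun g _ => H g) 1 s
        (List.ofFn fun k => (γ k, β k, β k + α k)) := by
    intro K
    induction K with
    | zero => intros; simp [pathProd]
    | succ K ih =>
      intro γ α β hlast
      have ih' := ih (fun k => γ k.succ) (fun k => α k.succ) (fun k => β k.succ)
        (fun k hk => hlast k.succ (by simp [hk]))
      rw [List.ofFn_succ, List.ofFn_succ, List.reverse_cons, List.prod_append, pathProd, ← ih']
      congr 1
      · congr 3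
        ext1 k
        congr 1
        by_cases hk : (k : ℕ) + 1 < K
        · rw [dif_pos hk, dif_pos (by simpa using hk)]
          rfl
        · rw [dif_neg hk, dif_neg (by simpa using hk)]
      · rw [List.prod_singleton]
        simp only [letterHam, timeEvolution_const (hsa _), timeEvolution_const hsa₀.neg]
        congr 1
        · cases K with
          | zero =>
            have := hlast 0 rfl
            simp [nextStart, this]
          | succ K =>
            rw [dif_pos (by simp), List.ofFn_succ]
            simp only [nextStart]
            congr 1
            rw [smul_neg, ← neg_smul]
            congr 1
            rw [← mul_neg, ← Complex.ofReal_neg]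
            congr 2
            simp only [Fin.val_zero, zero_add, ← sub_mul, ← neg_mul, neg_sub]
            rfl
        · congr 4
          ring
  exact key K F.γ F.α F.β fun k hk => by
    have : k = ⟨K - 1, Nat.sub_lt F.K_pos Nat.one_pos⟩ := Fin.ext (by simp; omega)
    rw [this]
    exact F.β_add_α_last

end Products

end TimeDepPF
end

/-! ### Coefficient polynomials in noncommuting generators -/

noncomputable section

namespace TimeDepPF

section Algebra

variable {Γ : ℕ}

/-- The `n`-th coefficient in `s` of `exp (-s (∑ g, D_g - (Γ - 1) D_none))`. -/
def totalPoly {R : Type*} [Ring R] [Algebra ℝ R] (D : Option (Fin Γ) → R) (n : ℕ) : R :=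
  ((-1) ^ n / (n.factorial : ℝ)) • (∑ g, D (some g) - ((Γ : ℝ) - 1) • D none) ^ n

variable {X Y : Type*} [AddCommGroup X] [Module ℝ X] [AddCommGroup Y] [Module ℝ Y]

theorem pow_apply_map {A : Module.End ℝ X} {B : Module.End ℝ Y} (c : X →ₗ[ℝ] Y)
    (h : ∀ v, B (c v) = c (A v)) (n : ℕ) (v : X) : (B ^ n) (c v) = c ((A ^ n) v) := by
  induction n with
  | zero => simp
  | succ n ih => rw [pow_succ', pow_succ', Module.End.mul_apply, Module.End.mul_apply, ih, h]

theorem chainPoly_apply_map {ι : Type*} {D : ι → Module.End ℝ X} {D' : ι → Module.End ℝ Y}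
    (c : X →ₗ[ℝ] Y) (h : ∀ g v, D' g (c v) = c (D g v)) (x₀ : ℝ) (l : List (ι × ℝ)) (n : ℕ)
    (v : X) : chainPoly D' x₀ l n (c v) = c (chainPoly D x₀ l n v) := by
  induction l generalizing x₀ n v with
  | nil => by_cases hn : n = 0 <;> simp [chainPoly, hn]
  | cons y l ih =>
    simp only [chainPoly, LinearMap.sum_apply, LinearMap.smul_apply, Module.End.mul_apply,
      map_sum, map_smul, pow_apply_map c (h y.1), ih]

theorem totalPoly_apply_map {D : Option (Fin Γ) → Module.End ℝ X}
    {D' : Option (Fin Γ) → Module.End ℝ Y}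
    (c : X →ₗ[ℝ] Y) (h : ∀ g v, D' g (c v) = c (D g v)) (n : ℕ)
    (v : X) : totalPoly D' n (c v) = c (totalPoly D n v) := by
  simp only [totalPoly, LinearMap.smul_apply, map_smul]
  rw [pow_apply_map c]
  simp [h]

theorem pow_apply_mem {p : ℕ} (N : ℕ → Submodule ℝ X) {A : Module.End ℝ X}
    (h : ∀ j < p, ∀ v ∈ N j, A v ∈ N (j + 1)) (n : ℕ) {j : ℕ} (hj : j + n ≤ p) {v : X}
    (hv : v ∈ N j) : (A ^ n) v ∈ N (j + n) := by
  induction n with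
  | zero => simpa using hv
  | succ n ih =>
    rw [pow_succ', Module.End.mul_apply]
    have hj' : j + n < p := by rw [← add_assoc] at hj; exact hj
    exact h _ hj' _ (ih hj'.le)

theorem chainPoly_apply_mem {ι : Type*} {p : ℕ} (N : ℕ → Submodule ℝ X) {D : ι → Module.End ℝ X}
    (h : ∀ g, ∀ j < p, ∀ v ∈ N j, D g v ∈ N (j + 1)) (x₀ : ℝ) (l : List (ι × ℝ)) (n : ℕ) {j : ℕ}
    (hj : j + n ≤ p) {v : X} (hv : v ∈ N j) : chainPoly D x₀ l n v ∈ N (j + n) := by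
  induction l generalizing x₀ n j v with
  | nil =>
    by_cases hn : n = 0
    · subst hn; simpa [chainPoly] using hv
    · simp [chainPoly, hn]
  | cons y l ih =>
    simp only [chainPoly, LinearMap.sum_apply, LinearMap.smul_apply, Module.End.mul_apply]
    refine Submodule.sum_mem _ fun ij hij => Submodule.smul_mem _ _ ?_
    have hij' : ij.1 + ij.2 = n := by simpa using hij
    have := ih y.2 ij.2 (j := j + ij.1) (by omega) (pow_apply_mem N (h y.1) ij.1 (by omega) hv)
    rwa [add_assoc, hij'] at this

theorem totalPoly_apply_mem {p : ℕ} (N : ℕ → Submodule ℝ X) {D : Option (Fin Γ) → Module.End ℝ X}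
    (h : ∀ g, ∀ j < p, ∀ v ∈ N j, D g v ∈ N (j + 1)) (n : ℕ) {j : ℕ}
    (hj : j + n ≤ p) {v : X} (hv : v ∈ N j) : totalPoly D n v ∈ N (j + n) := by
  simp only [totalPoly, LinearMap.smul_apply]
  refine Submodule.smul_mem _ _ (pow_apply_mem N (fun j hj v hv => ?_) n hj hv)
  simp only [LinearMap.sub_apply, LinearMap.sum_apply, LinearMap.smul_apply]
  exact Submodule.sub_mem _ (Submodule.sum_mem _ fun g _ => h _ j hj v hv)
    (Submodule.smul_mem _ _ (h _ j hj v hv))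

theorem chainPoly_singleton {R : Type*} [Ring R] [Algebra ℝ R] (D : R) (n : ℕ) :
    chainPoly (fun _ : Unit => D) 0 [((), 1)] n = ((-1) ^ n / (n.factorial : ℝ)) • D ^ n := by
  rw [chainPoly, Finset.sum_eq_single (n, 0)]
  · simp [chainPoly]
  · rintro ⟨i, j⟩ hij hne
    have hij' : i + j = n := by simpa using hij
    have : j ≠ 0 := by
      rintro rfl
      exact hne (by simpa using hij')
    simp [chainPoly, this]
  · simp

end Algebra

section Asymptotics

variable {X : Type*} [NormedAddCommGroup X] [NormedSpace ℝ X]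

/-- The limit `s → 0` kills the constant term; division by `s` lowers the degree. -/
theorem coeff_eq_zero_of_isBigO (q : ℕ) (r : ℕ → X)
    (h : (fun s : ℝ => ∑ m ∈ Finset.range q, s ^ m • r m) =O[𝓝[>] 0] fun s => s ^ q) :
    ∀ m < q, r m = 0 := by
  induction q generalizing r with
  | zero => intro m hm; omega
  | succ q ih =>
    have h0 : r 0 = 0 := by
      have h1 : Tendsto (fun s : ℝ => ∑ m ∈ Finset.range (q + 1), s ^ m • r m) (𝓝[>] 0)
          (𝓝 (∑ m ∈ Finset.range (q + 1), (0 : ℝ) ^ m • r m)) :=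
        (Continuous.tendsto (by fun_prop) 0).mono_left nhdsWithin_le_nhds
      have h2 : Tendsto (fun s : ℝ => s ^ (q + 1)) (𝓝[>] 0) (𝓝 0) := by
        have := (Continuous.tendsto (f := fun s : ℝ => s ^ (q + 1)) (by fun_prop) 0).mono_left
          (nhdsWithin_le_nhds (s := Ioi 0))
        simpa using this
      have := tendsto_nhds_unique h1 (h.trans_tendsto h2)
      rw [Finset.sum_range_succ'] at this
      simpa using this
    have h1 : (fun s : ℝ => ∑ m ∈ Finset.range q, s ^ m • r (m + 1)) =O[𝓝[>] 0]
        fun s => s ^ q := by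
      have h2 : (fun s : ℝ => s⁻¹ • ∑ m ∈ Finset.range (q + 1), s ^ m • r m) =O[𝓝[>] 0]
        fun s => s⁻¹ • s ^ (q + 1) := (isBigO_refl _ _).smul h
      refine h2.congr' ?_ ?_ <;> filter_upwards [self_mem_nhdsWithin] with s hs
      · rw [Finset.sum_range_succ', h0, smul_zero, add_zero, Finset.smul_sum]
        refine Finset.sum_congr rfl fun m _ => ?_
        rw [smul_smul, pow_succ', inv_mul_cancel_left₀ (ne_of_gt hs)]
      · rw [smul_eq_mul, pow_succ', inv_mul_cancel_left₀ (ne_of_gt hs)]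
    intro m hm
    cases m with
    | zero => exact h0
    | succ m => exact ih (fun m => r (m + 1)) h1 m (by omega)

theorem isBigO_chainVal_sub [CompleteSpace X] {ι : Type*} {n : ℕ} {Φ : ι → ℝ → ℝ → X →ₗ[ℝ] X}
    {D : ι → Module.End ℝ (ℝ → X)} (h : ∀ g, IsPropagator (Φ g) (D g) n) {q : ℕ} (hq : q ≤ n)
    {f : ℝ → X} (hf : ContDiff ℝ (q + 1 : ℕ) f) {x₀ : ℝ}
    (hx₀ : x₀ ∈ Icc (0 : ℝ) 1) (l : List (ι × ℝ)) (hl : ∀ y ∈ l, y.2 ∈ Icc (0 : ℝ) 1) :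
    (fun s => chainVal Φ s x₀ l (f (x₀ * s)) -
        ∑ m ∈ Finset.range (q + 1), s ^ m • chainPoly D x₀ l m f (chainEnd x₀ l * s))
      =O[𝓝[>] 0] fun s => s ^ (q + 1) := by
  have hc : Continuous (sortedNorm D (l.map Prod.fst) (q + 1) f) :=
    continuous_sortedNorm h _ (by omega) hf
  have hI : (fun s : ℝ => ∫ x in 0..s, sortedNorm D (l.map Prod.fst) (q + 1) f x)
      =O[𝓝[>] 0] fun s : ℝ => s := by
    have hd := intervalIntegral.integral_hasDerivAt_right (hc.intervalIntegrable 0 0)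
      (hc.stronglyMeasurableAtFilter _ _) hc.continuousAt
    have := hd.isBigO_sub
    simp only [intervalIntegral.integral_same, sub_zero] at this
    exact this.mono nhdsWithin_le_nhds
  refine IsBigO.trans ?_ ((isBigO_refl (fun s : ℝ => s ^ q) (𝓝[>] 0)).mul hI)
  refine IsBigO.of_bound 1 ?_
  filter_upwards [self_mem_nhdsWithin] with s hs
  rw [one_mul]
  exact (norm_chainVal_sub_le h hq hf (le_of_lt hs) hx₀ l hl).trans (Real.le_norm_self _)

end Asymptotics

/-! ### Universality of the truncated Fock space -/

section Fock

variable (Γ p : ℕ)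

/-- Words of length at most `p` in the letters `Option (Fin Γ)`. -/
abbrev Word : Type := {u : List (Option (Fin Γ)) // u.length ≤ p}

instance : Fintype (Word Γ p) :=
  (List.finite_length_le (Option (Fin Γ)) p).fintype

/-- The truncated Fock space over the letters. -/
abbrev Fock : Type := EuclideanSpace ℂ (Word Γ p)

variable {Γ p}

/-- The matrix of the sum of the creation and the annihilation operator of a letter. -/
def fieldMatrix (g : Option (Fin Γ)) : Matrix (Word Γ p) (Word Γ p) ℂ :=
  Matrix.of fun u v => if u.1 = g :: v.1 ∨ v.1 = g :: u.1 then 1 else 0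

/-- The sum of the creation and the annihilation operator of a letter. -/
def fieldOp (g : Option (Fin Γ)) : Fock Γ p →L[ℂ] Fock Γ p :=
  LinearMap.toContinuousLinearMap (Matrix.toEuclideanLin (fieldMatrix g))

/-- Creation operators alone would separate words, but the order condition concerns Hermitian
operators only. Adding the annihilation part repairs this at the price of shorter words, which
`lowPairs` discards. -/
theorem isSymmetric_fieldOp (g : Option (Fin Γ)) :
    ((fieldOp g : Fock Γ p →L[ℂ] Fock Γ p) : Fock Γ p →ₗ[ℂ] Fock Γ p).IsSymmetric := by
  refine Matrix.isSymmetric_toEuclideanLin_iff.2 ?_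
  ext u v
  simp only [fieldMatrix, Matrix.conjTranspose_apply, Matrix.of_apply, or_comm]
  split_ifs <;> simp

theorem fieldOp_apply (g : Option (Fin Γ)) (v : Fock Γ p) (u : Word Γ p) :
    fieldOp g v u = ∑ w, (if u.1 = g :: w.1 ∨ w.1 = g :: u.1 then 1 else 0) * v w := by
  simp [fieldOp, Matrix.toLpLin_apply, Matrix.mulVec, dotProduct, fieldMatrix]

/-- The factors relating the letters to Hamiltonians: `i` for a term, `-i` for the shift. -/
def letterPhase : Option (Fin Γ) → ℂ
  | none => -Complex.I
  | some _ => Complex.I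

theorem letterPhase_ne_zero (g : Option (Fin Γ)) : letterPhase g ≠ 0 := by
  cases g <;> simp [letterPhase]

/-- The product of the phases of a word. -/
def wordPhase : List (Option (Fin Γ)) → ℂ
  | [] => 1
  | g :: u => letterPhase g * wordPhase u

theorem wordPhase_ne_zero (u : List (Option (Fin Γ))) : wordPhase u ≠ 0 := by
  induction u with
  | nil => simp [wordPhase]
  | cons g u ih => exact mul_ne_zero (letterPhase_ne_zero g) ih

/-- The generator `letterPhase g • fieldOp g` as a real-linear map. -/
def fockGen (g : Option (Fin Γ)) : Module.End ℝ (Fock Γ p) :=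
  ((letterPhase g • fieldOp g : Fock Γ p →L[ℂ] Fock Γ p) : Fock Γ p →ₗ[ℂ] Fock Γ p).restrictScalars ℝ

theorem fockGen_apply (g : Option (Fin Γ)) (v : Fock Γ p) :
    fockGen g v = letterPhase g • fieldOp g v := rfl

variable {M : Type*} [AddCommGroup M] [Module ℝ M]

/-- A word of operators applied to `f`; the head of the word is applied last. -/
def wordApply (D : Option (Fin Γ) → Module.End ℝ M) (f : M) : List (Option (Fin Γ)) → M
  | [] => f
  | g :: u => D g (wordApply D f u)

variable (p) in
/-- The pairs whose first component is supported on words shorter than `j` and whose second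
component vanishes. -/
def lowPairs (Γ : ℕ) (M : Type*) [AddCommGroup M] [Module ℝ M] (j : ℕ) :
    Submodule ℝ (Fock Γ p × M) where
  carrier := {x | x.2 = 0 ∧ ∀ u : Word Γ p, j ≤ u.1.length → x.1 u = 0}
  add_mem' {x y} hx hy := ⟨by simp [hx.1, hy.1], fun u hu => by simp [hx.2 u hu, hy.2 u hu]⟩
  zero_mem' := ⟨rfl, fun u _ => rfl⟩
  smul_mem' c x hx := ⟨by simp [hx.1], fun u hu => by simp [hx.2 u hu]⟩

/-- The span of the pairs of a word of length `j` in the Fock space and in `M`, modulo `lowPairs`. -/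
def wordPairs (p : ℕ) (D : Option (Fin Γ) → Module.End ℝ M) (f : M) (j : ℕ) :
    Submodule ℝ (Fock Γ p × M) :=
  Submodule.span ℝ {x | ∃ u : Word Γ p, u.1.length = j ∧
    x = (EuclideanSpace.single u (wordPhase u.1), wordApply D f u.1)} ⊔ lowPairs p Γ M j

/-- Creation prepends the letter in the Fock space just as `D g` does in `M`; it is not truncated
because `j < p`. Annihilation, and every image of a word shorter than `j`, stays below length `j +
1`. -/
theorem prodMap_mem_wordPairs (D : Option (Fin Γ) → Module.End ℝ M) (f : M) (g : Option (Fin Γ))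
    (j : ℕ) (hj : j < p) (x : Fock Γ p × M) (hx : x ∈ wordPairs p D f j) :
    (fockGen g).prodMap (D g) x ∈ wordPairs p D f (j + 1) := by
  rw [wordPairs, Submodule.mem_sup] at hx
  obtain ⟨y, hy, z, hz, rfl⟩ := hx
  rw [map_add]
  refine Submodule.add_mem _ ?_ ?_
  · have hle : Submodule.span ℝ {x | ∃ u : Word Γ p, u.1.length = j ∧
        x = (EuclideanSpace.single u (wordPhase u.1), wordApply D f u.1)} ≤
        (wordPairs p D f (j + 1)).comap ((fockGen g).prodMap (D g)) := by
      rw [Submodule.span_le]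
      rintro _ ⟨u, hu, rfl⟩
      let gu : Word Γ p := ⟨g :: u.1, by simp [hu]; omega⟩
      have h1 : ((EuclideanSpace.single gu (wordPhase gu.1), wordApply D f gu.1) : Fock Γ p × M) ∈
          wordPairs p D f (j + 1) :=
        Submodule.mem_sup_left (Submodule.subset_span ⟨gu, by simp [gu, hu], rfl⟩)
      have h2 : (fockGen g (EuclideanSpace.single u (wordPhase u.1)) -
          EuclideanSpace.single gu (wordPhase gu.1), (0 : M)) ∈ lowPairs p Γ M (j + 1) := by
        refine ⟨rfl, fun w hw => ?_⟩
        have hne : u.1 ≠ g :: w.1 := fun h => by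
          have := congrArg List.length h
          simp at this; omega
        rw [fockGen_apply]
        simp only [PiLp.sub_apply, PiLp.smul_apply, fieldOp_apply, PiLp.single_apply]
        rw [Finset.sum_eq_single u (fun b _ hb => by simp [hb]) (by simp)]
        have hiff : w = gu ↔ w.1 = g :: u.1 := Subtype.ext_iff
        by_cases h : w.1 = g :: u.1 <;> simp [h, hiff, hne, gu, wordPhase]
      have := Submodule.add_mem _ h1 (Submodule.mem_sup_right h2)
      simpa [wordApply, gu] using this
    exact hle hy
  · refine Submodule.mem_sup_right ⟨by simp [hz.1], fun u hu => ?_⟩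
    simp only [LinearMap.prodMap_apply, fockGen_apply, PiLp.smul_apply, fieldOp_apply]
    rw [Finset.sum_eq_zero, smul_zero]
    intro w _
    by_cases h : u.1 = g :: w.1 ∨ w.1 = g :: u.1
    · rw [hz.2 w, mul_zero]
      rcases h with h | h
      · have := congrArg List.length h; simp at this; omega
      · have := congrArg List.length h; simp at this; omega
    · simp [h]

/-- Distinct words are independent in the Fock space, so the components on words of length `j`
determine the second entry. -/
theorem snd_eq_zero_of_mem_wordPairs (D : Option (Fin Γ) → Module.End ℝ M) (f : M) {j : ℕ}
    {m : M} (h : ((0 : Fock Γ p), m) ∈ wordPairs p D f j) : m = 0 := by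
  let L : Fock Γ p × M → M := fun x => x.2 -
    ∑ u : Word Γ p, (if u.1.length = j then (x.1 u / wordPhase u.1).re else 0) • wordApply D f u.1
  have hLadd : ∀ x y, L (x + y) = L x + L y := by
    intro x y
    simp only [L, Prod.snd_add, Prod.fst_add, PiLp.add_apply, add_div, Complex.add_re]
    have : ∀ u : Word Γ p, (if u.1.length = j then
          (x.1 u / wordPhase u.1).re + (y.1 u / wordPhase u.1).re else 0) =
        (if u.1.length = j then (x.1 u / wordPhase u.1).re else 0) +
          if u.1.length = j then (y.1 u / wordPhase u.1).re else 0 := fun u => by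
      split_ifs <;> simp
    simp only [this, add_smul, Finset.sum_add_distrib]
    abel
  have hLsmul : ∀ (c : ℝ) x, L (c • x) = c • L x := by
    intro c x
    simp only [L, Prod.smul_snd, Prod.smul_fst, PiLp.smul_apply, smul_sub, Finset.smul_sum,
      smul_smul]
    congr 1
    refine Finset.sum_congr rfl fun u _ => ?_
    congr 1
    split_ifs
    · rw [Complex.real_smul, mul_div_assoc, Complex.re_ofReal_mul]
    · simp
  let Lin : Fock Γ p × M →ₗ[ℝ] M := { toFun := L, map_add' := hLadd, map_smul' := hLsmul }
  have hle : wordPairs p D f j ≤ LinearMap.ker Lin := by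
    refine sup_le (Submodule.span_le.2 ?_) ?_
    · rintro _ ⟨u, hu, rfl⟩
      change wordApply D f u.1 - _ = 0
      rw [Finset.sum_eq_single u]
      · simp [hu, wordPhase_ne_zero]
      · intro b _ hb
        simp [hb]
      · simp
    · rintro x ⟨hx1, hx2⟩
      change x.2 - _ = 0
      rw [hx1, Finset.sum_eq_zero, sub_zero]
      intro u _
      split_ifs with hu
      · simp [hx2 u hu.ge]
      · simp
  have := hle h
  change m - _ = 0 at this
  simpa using this

/-- Universality of the truncated Fock space: an identity of the coefficients up to order `p` that
holds on the vacuum holds for all operators. -/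
theorem chainPoly_eq_totalPoly_of_fock (x₀ : ℝ) (l : List (Option (Fin Γ) × ℝ)) {n : ℕ}
    (hn : n ≤ p) (v₀ : Fock Γ p)
    (hv₀ : v₀ = EuclideanSpace.single ⟨[], Nat.zero_le p⟩ 1)
    (h : chainPoly (fockGen (Γ := Γ) (p := p)) x₀ l n v₀ = totalPoly fockGen n v₀)
    (D : Option (Fin Γ) → Module.End ℝ M) (f : M) :
    chainPoly D x₀ l n f = totalPoly D n f := by
  let B : Option (Fin Γ) → Module.End ℝ (Fock Γ p × M) := fun g => (fockGen g).prodMap (D g)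
  have h0 : (v₀, f) ∈ wordPairs p D f 0 := by
    refine Submodule.mem_sup_left (Submodule.subset_span ⟨⟨[], Nat.zero_le p⟩, rfl, ?_⟩)
    simp [hv₀, wordPhase, wordApply]
  have hB : ∀ g, ∀ j < p, ∀ v ∈ wordPairs p D f j, B g v ∈ wordPairs p D f (j + 1) :=
    fun g j hj x hx => prodMap_mem_wordPairs D f g j hj x hx
  -- Both polynomials are homogeneous of degree `n`, so acting on the pair of vacuum and `f` they
  -- stay in the relation at level `n`; their difference has first component `0` by hypothesis.
  have h1 := Submodule.sub_mem _
    (chainPoly_apply_mem _ hB x₀ l n (j := 0) (by omega) h0)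
    (totalPoly_apply_mem _ hB n (j := 0) (by omega) h0)
  have h2 : chainPoly B x₀ l n (v₀, f) - totalPoly B n (v₀, f) =
      (0, chainPoly D x₀ l n f - totalPoly D n f) := by
    refine Prod.ext ?_ ?_
    · have e1 := chainPoly_apply_map (D := B) (D' := fockGen (Γ := Γ) (p := p))
        (LinearMap.fst ℝ _ M) (fun g v => rfl) x₀ l n (v₀, f)
      have e2 := totalPoly_apply_map (D := B) (D' := fockGen (Γ := Γ) (p := p))
        (LinearMap.fst ℝ _ M) (fun g v => rfl) n (v₀, f)
      simp only [LinearMap.fst_apply] at e1 e2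
      rw [Prod.fst_sub, ← e1, ← e2, h, sub_self]
    · have e1 := chainPoly_apply_map (D := B) (D' := D)
        (LinearMap.snd ℝ (Fock Γ p) M) (fun g v => rfl) x₀ l n (v₀, f)
      have e2 := totalPoly_apply_map (D := B) (D' := D)
        (LinearMap.snd ℝ (Fock Γ p) M) (fun g v => rfl) n (v₀, f)
      simp only [LinearMap.snd_apply] at e1 e2
      rw [Prod.snd_sub, ← e1, ← e2]
  rw [h2] at h1
  exact sub_eq_zero.1 (snd_eq_zero_of_mem_wordPairs D f h1)

end Fock

end TimeDepPF
end

/-! ### From the time-independent counterpart to time-dependent Hamiltonians -/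

noncomputable section

namespace TimeDepPF

section Order

variable {E : Type*} [NormedAddCommGroup E] [InnerProductSpace ℂ E] {Γ : ℕ}

theorem letterHam_contDiff {n : ℕ} {H₀ : ℝ → E →L[ℂ] E} {H : Fin Γ → ℝ → E →L[ℂ] E}
    (hH₀ : ContDiff ℝ n H₀) (hH : ∀ g, ContDiff ℝ n (H g)) (o : Option (Fin Γ)) :
    ContDiff ℝ n (letterHam H₀ H o) := by
  cases o
  exacts [hH₀, hH _]

/-- Each of the `Γ` generators contains one `d/dx`; all but one must be removed. This is the
combination in the exponent of the counterpart, with the shift generator standing for `-H₀`. -/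
theorem leftGen_sum (H : Fin Γ → ℝ → E →L[ℂ] E) :
    leftGen (fun x => ∑ g, H g x) = ∑ g, leftGen (letterHam 0 H (some g)) -
      ((Γ : ℝ) - 1) • leftGen (letterHam 0 H none) := by
  have h0 : mulOp (0 : ℝ → E →L[ℂ] E) = 0 := by
    ext f x : 2
    simp [mulOp]
  have h1 : mulOp (fun x => ∑ g, H g x) = ∑ g, mulOp (H g) := by
    refine LinearMap.ext fun f => ?_
    ext1 x
    simp [mulOp, Finset.sum_mul, Finset.smul_sum]
  simp only [leftGen, letterHam_none, letterHam_some, h0, h1, Finset.sum_add_distrib,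
    Finset.sum_const, Finset.card_univ, Fintype.card_fin, add_zero]
  rw [sub_smul (Γ : ℝ) 1 (derivEnd (E →L[ℂ] E)), one_smul, Nat.cast_smul_eq_nsmul]
  abel

variable [CompleteSpace E]

theorem letterHam_isSelfAdjoint {H₀ : ℝ → E →L[ℂ] E} {H : Fin Γ → ℝ → E →L[ℂ] E}
    (hH₀ : ∀ x, IsSelfAdjoint (H₀ x)) (hH : ∀ g x, IsSelfAdjoint (H g x)) (o : Option (Fin Γ))
    (x : ℝ) : IsSelfAdjoint (letterHam H₀ H o x) := by
  cases o
  exacts [hH₀ x, hH _ x]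

variable [FiniteDimensional ℂ E]

theorem isBigO_pathProd_sub {K p : ℕ} (F : ProductFormula Γ K)
    {H : Option (Fin Γ) → ℝ → E →L[ℂ] E} (hH : ∀ o, ContDiff ℝ p (H o))
    (hsa : ∀ o x, IsSelfAdjoint (H o x)) :
    (fun s => pathProd H 1 s F.factors - ∑ m ∈ Finset.range (p + 1),
        s ^ m • chainPoly (fun o => leftGen (H o)) 0 (factorPath 1 F.factors) m
          (fun _ => (1 : E →L[ℂ] E)) s) =O[𝓝[>] 0] fun s => s ^ (p + 1) := by
  have h := isBigO_chainVal_sub (n := p) (Φ := fun o => leftProp (H o))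
    (D := fun o => leftGen (H o)) (fun o => isPropagator_left (hH o) (hsa o)) le_rfl
    (f := fun _ => (1 : E →L[ℂ] E)) contDiff_const (x₀ := 0) (by simp) (factorPath 1 F.factors)
    (factorPath_mem (by simp) fun x hx => F.mem_factors hx)
  have hend := chainEnd_factorPath 1 F.factors
  have hval := fun s => chainVal_left_eq H 1 s F.factors 1
  simp only [F.nextStart_factors 1] at hend hval
  simpa only [hend, hval, mul_one, one_mul] using h

theorem isBigO_timeEvolution_sub {p : ℕ} {H : ℝ → E →L[ℂ] E} (hH : ContDiff ℝ p H)
    (hsa : ∀ x, IsSelfAdjoint (H x)) :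
    (fun s => timeEvolution H s 0 - ∑ m ∈ Finset.range (p + 1),
        s ^ m • (((-1) ^ m / (m.factorial : ℝ)) • leftGen H ^ m) (fun _ => (1 : E →L[ℂ] E)) s)
      =O[𝓝[>] 0] fun s => s ^ (p + 1) := by
  have h := isBigO_chainVal_sub (n := p) (ι := Unit) (Φ := fun _ => leftProp H)
    (D := fun _ => leftGen H) (fun _ => isPropagator_left hH hsa) le_rfl
    (f := fun _ => (1 : E →L[ℂ] E)) contDiff_const (x₀ := 0) (by simp) [((), 1)] (by simp)
  simp only [chainPoly_singleton] at h
  simpa [chainVal, chainEnd, leftProp] using h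

omit [CompleteSpace E] [FiniteDimensional ℂ E] in
theorem leftGen_const_apply (A v : E →L[ℂ] E) :
    leftGen (fun _ => A) (fun _ => v) = fun _ => Complex.I • (A * v) := by
  have : derivEnd (E →L[ℂ] E) (fun _ => v) = 0 := by
    rw [derivEnd_apply (differentiable_const v)]
    simp [Pi.zero_def]
  rw [leftGen, LinearMap.add_apply, this, zero_add]
  rfl

/-- The generator `i H` of a constant Hamiltonian as a real-linear map. -/
def constGen {W : Type*} [NormedAddCommGroup W] [InnerProductSpace ℂ W] (H : W →L[ℂ] W) :
    Module.End ℝ W :=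
  ((Complex.I • H : W →L[ℂ] W) : W →ₗ[ℂ] W).restrictScalars ℝ

/-- The Hamiltonians `-H₀` for the shift and `H g` for the terms. -/
def constHam {W : Type*} [NormedAddCommGroup W] [InnerProductSpace ℂ W] (H₀ : W →L[ℂ] W)
    (H : Fin Γ → W →L[ℂ] W) : Option (Fin Γ) → W →L[ℂ] W
  | none => -H₀
  | some g => H g

/-- On constant functions `d/dx` vanishes and the generators reduce to left multiplication by `i`
times constant operators. The Taylor coefficients are then independent of `s`, so the order
condition can be compared power by power. -/
theorem ProductFormula.CounterpartHasOrder.chainPoly_eq {K p : ℕ} {F : ProductFormula Γ K}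
    (hF : F.CounterpartHasOrder p) {n : ℕ} (hn : n ≤ p) {W : Type} [NormedAddCommGroup W]
    [InnerProductSpace ℂ W] [FiniteDimensional ℂ W] [CompleteSpace W] {H₀ : W →L[ℂ] W}
    {H : Fin Γ → W →L[ℂ] W} (hH₀ : IsSelfAdjoint H₀) (hH : ∀ g, IsSelfAdjoint (H g)) (w : W) :
    chainPoly (fun o => constGen (constHam H₀ H o)) 0 (factorPath 1 F.factors) n w =
      totalPoly (fun o => constGen (constHam H₀ H o)) n w := by
  have hconst : ∀ o, letterHam (fun _ => -H₀) (fun g _ => H g) o = fun _ => constHam H₀ H o := by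
    intro o
    cases o <;> rfl
  let X : Option (Fin Γ) → Module.End ℝ (W →L[ℂ] W) := fun o =>
    LinearMap.mulLeft ℝ (Complex.I • constHam H₀ H o)
  let c : (W →L[ℂ] W) →ₗ[ℝ] (ℝ → W →L[ℂ] W) :=
    { toFun := fun v _ => v, map_add' := fun _ _ => rfl, map_smul' := fun _ _ => rfl }
  have hXc : ∀ o v, leftGen (letterHam (fun _ => -H₀) (fun g _ => H g) o) (c v) = c (X o v) := by
    intro o v
    rw [hconst]
    refine (leftGen_const_apply (constHam H₀ H o) v).trans ?_
    ext1 x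
    simp [c, X]
  have hsmul : ∀ T : W →L[ℂ] W, ((Γ : ℂ) - 1) • T = ((Γ : ℝ) - 1) • T := by
    intro T
    ext w
    rw [smul_apply, smul_apply, ← Complex.coe_smul]
    simp
  set B : W →L[ℂ] W := ∑ g, H g + ((Γ : ℂ) - 1) • H₀ with hB
  have hBsa : IsSelfAdjoint B := by
    have h1 : IsSelfAdjoint ((Γ : ℂ) - 1) := by simp [isSelfAdjoint_iff]
    exact IsSelfAdjoint.add (isSelfAdjoint_sum _ fun g _ => hH g) (h1.smul hH₀)
  have hBc : ∀ v, leftGen (fun _ => B) (c v) =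
      c ((∑ g, X (some g) - ((Γ : ℝ) - 1) • X none) v) := by
    intro v
    refine (leftGen_const_apply B v).trans ?_
    ext1 x
    simp only [c, X, hB, constHam, LinearMap.coe_mk, AddHom.coe_mk,
      LinearMap.sub_apply, LinearMap.sum_apply, LinearMap.smul_apply, LinearMap.mulLeft_apply,
      add_mul, Finset.sum_mul, smul_add, Finset.smul_sum, smul_mul_assoc, smul_neg, neg_mul,
      sub_neg_eq_add]
    rw [smul_comm, hsmul]
  have hexp := isBigO_timeEvolution_sub (p := p) (H := fun _ => B) contDiff_const fun _ => hBsa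
  have hpath := isBigO_pathProd_sub (p := p) F
    (letterHam_contDiff contDiff_const fun _ => contDiff_const)
    (letterHam_isSelfAdjoint (H₀ := fun _ => -H₀) (H := fun g _ => H g) (fun _ => hH₀.neg)
      fun g _ => hH g)
  have hord := hF W H₀ H (ContinuousLinearMap.isSelfAdjoint_iff_isSymmetric.1 hH₀)
    fun g => ContinuousLinearMap.isSelfAdjoint_iff_isSymmetric.1 (hH g)
  have hdiff : (fun s : ℝ => ∑ m ∈ Finset.range (p + 1), s ^ m •
      (chainPoly X 0 (factorPath 1 F.factors) m 1 - totalPoly X m 1)) =O[𝓝[>] 0]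
        fun s => s ^ (p + 1) := by
    refine ((hexp.sub hpath).sub hord).congr_left fun s => ?_
    have e1 : ∀ m, chainPoly (fun o => leftGen (letterHam (fun _ => -H₀) (fun g _ => H g) o)) 0
        (factorPath 1 F.factors) m (fun _ => 1) s = chainPoly X 0 (factorPath 1 F.factors) m 1 :=
      fun m => congrFun (chainPoly_apply_map c hXc 0 _ m 1) s
    have e2 : ∀ m : ℕ, (((-1) ^ m / (m.factorial : ℝ)) • leftGen (fun _ => B) ^ m)
        (fun _ => 1) s = totalPoly X m 1 := fun m => by
      have := pow_apply_map (B := leftGen fun _ => B) c hBc m 1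
      rw [LinearMap.smul_apply, totalPoly, LinearMap.smul_apply, Pi.smul_apply]
      exact congrArg _ (congrFun this s)
    rw [F.T_eq_pathProd hH₀ hH, timeEvolution_const hBsa]
    simp only [e1, e2, smul_sub, Finset.sum_sub_distrib, sub_zero]
    abel
  have heq := sub_eq_zero.1 (coeff_eq_zero_of_isBigO _ _ hdiff n (by omega))
  let ev : (W →L[ℂ] W) →ₗ[ℝ] W :=
    { toFun := fun v => v w, map_add' := fun _ _ => rfl, map_smul' := fun _ _ => rfl }
  have hev : ∀ o v, constGen (constHam H₀ H o) (ev v) = ev (X o v) := fun o v => rfl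
  have h1 := chainPoly_apply_map ev hev 0 (factorPath 1 F.factors) n 1
  have h2 := totalPoly_apply_map ev hev n 1
  rw [← heq] at h2
  exact h1.trans h2.symm

theorem ProductFormula.CounterpartHasOrder.chainPoly_fock {K p : ℕ} {F : ProductFormula Γ K}
    (hF : F.CounterpartHasOrder p) {n : ℕ} (hn : n ≤ p) (v₀ : Fock Γ p) :
    chainPoly (fockGen (Γ := Γ) (p := p)) 0 (factorPath 1 F.factors) n v₀ =
      totalPoly fockGen n v₀ := by
  have hsa : ∀ g, IsSelfAdjoint (fieldOp g : Fock Γ p →L[ℂ] Fock Γ p) := fun g =>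
    ContinuousLinearMap.isSelfAdjoint_iff_isSymmetric.2 (isSymmetric_fieldOp g)
  have h := hF.chainPoly_eq hn (hsa none) (fun g => hsa (some g)) v₀
  have hgen : (fun o => constGen (constHam (fieldOp none) (fun g => fieldOp (some g)) o)) =
      fockGen (Γ := Γ) (p := p) := by
    ext1 o
    refine LinearMap.ext fun v => ?_
    rw [fockGen_apply]
    cases o with
    | none => exact (smul_neg Complex.I _).trans (neg_smul Complex.I _).symm
    | some g => rfl
  rwa [hgen] at h

/-- A product formula whose time-independent counterpart has order `p` has order `p` for all
time-dependent Hamiltonians of class `C^p`. -/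
theorem ProductFormula.CounterpartHasOrder.hasOrderFor {K p : ℕ} {F : ProductFormula Γ K}
    (hF : F.CounterpartHasOrder p) {H : Fin Γ → ℝ → E →L[ℂ] E} (hH : ∀ g, ContDiff ℝ p (H g))
    (hsa : ∀ g x, IsSelfAdjoint (H g x)) : F.HasOrderFor H p := by
  have hU := isBigO_timeEvolution_sub (p := p) (H := fun x => ∑ g, H g x)
    (ContDiff.sum fun g _ => hH g) fun x => isSelfAdjoint_sum _ fun g _ => hsa g x
  have hS := isBigO_pathProd_sub (p := p) F (letterHam_contDiff (H₀ := 0) contDiff_const hH)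
    (letterHam_isSelfAdjoint (fun _ => IsSelfAdjoint.zero _) hsa)
  refine (hU.sub hS).congr_left fun s => ?_
  have e : ∑ m ∈ Finset.range (p + 1), s ^ m •
        chainPoly (fun o => leftGen (letterHam 0 H o)) 0 (factorPath 1 F.factors) m
          (fun _ => (1 : E →L[ℂ] E)) s = ∑ m ∈ Finset.range (p + 1),
      s ^ m • (((-1) ^ m / (m.factorial : ℝ)) • leftGen (fun x => ∑ g, H g x) ^ m)
        (fun _ => (1 : E →L[ℂ] E)) s := by
    refine Finset.sum_congr rfl fun m hm => ?_
    -- The polynomial identity is applied to the generators `d/dx + i H_γ` and `d/dx` on all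
    -- operator-valued functions, at the constant function `1`.
    rw [chainPoly_eq_totalPoly_of_fock (p := p) 0 (factorPath 1 F.factors)
      (by rw [Finset.mem_range] at hm; omega) _ rfl
      (hF.chainPoly_fock (by rw [Finset.mem_range] at hm; omega) _), totalPoly, leftGen_sum]
  rw [e, pathProd_eq_factorProd, F.S_eq_factorProd]
  abel

end Order

end TimeDepPF
end

/-! ### Counting words: from sorted words along the path to the commutator factor -/

noncomputable section

namespace TimeDepPF

section Words

variable {X : Type*} [NormedAddCommGroup X] [NormedSpace ℝ X] {ι : Type*}

/-- The sum of the norms of all words of length `q` in the letters of the list `l`. -/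
def listNorm (D : ι → Module.End ℝ (ℝ → X)) (l : List ι) : ℕ → (ℝ → X) → ℝ → ℝ
  | 0, f, x => ‖f x‖
  | q + 1, f, x => (l.map fun g => listNorm D l q (D g f) x).sum

theorem listNorm_nonneg (D : ι → Module.End ℝ (ℝ → X)) (l : List ι) (q : ℕ) (f : ℝ → X) (x : ℝ) :
    0 ≤ listNorm D l q f x := by
  induction q generalizing f with
  | zero => exact norm_nonneg _
  | succ q ih =>
    refine List.sum_nonneg fun y hy => ?_
    obtain ⟨g, _, rfl⟩ := List.mem_map.1 hy
    exact ih _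

theorem sum_map_le_of_sublist {l l' : List ι} (h : List.Sublist l l') {φ : ι → ℝ}
    (hφ : ∀ i, 0 ≤ φ i) : (l.map φ).sum ≤ (l'.map φ).sum := by
  induction h with
  | slnil => simp
  | cons a _ ih => rw [List.map_cons, List.sum_cons]; linarith [hφ a]
  | cons_cons a _ ih => rw [List.map_cons, List.sum_cons, List.map_cons, List.sum_cons]; linarith

/-- Dropping the ordering constraint only adds nonnegative terms. The sublist lets one bound serve
every suffix of the path. -/
theorem sortedNorm_le_listNorm (D : ι → Module.End ℝ (ℝ → X)) {l l' : List ι}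
    (h : List.Sublist l l') (q : ℕ) (f : ℝ → X) (x : ℝ) :
    sortedNorm D l q f x ≤ listNorm D l' q f x := by
  induction q generalizing f l with
  | zero => rw [sortedNorm, listNorm]
  | succ q ihq =>
    refine le_trans ?_ (sum_map_le_of_sublist h fun g => listNorm_nonneg D l' q (D g f) x)
    induction l with
    | nil => simp [sortedNorm]
    | cons g l ih =>
      rw [sortedNorm, List.map_cons, List.sum_cons]
      exact add_le_add (ihq h _) (ih ((List.sublist_cons_self g l).trans h))

variable [Fintype ι]

/-- The sum of the norms of all words of length `q` in the operators `N i`. -/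
def wordSum (N : ι → Module.End ℝ (ℝ → X)) (q : ℕ) (f : ℝ → X) (x : ℝ) : ℝ :=
  ∑ w : Fin q → ι, ‖(List.ofFn w).foldl (fun f i => N i f) f x‖

theorem wordSum_zero (N : ι → Module.End ℝ (ℝ → X)) (f : ℝ → X) (x : ℝ) :
    wordSum N 0 f x = ‖f x‖ := by
  simp [wordSum]

theorem wordSum_succ (N : ι → Module.End ℝ (ℝ → X)) (q : ℕ) (f : ℝ → X) (x : ℝ) :
    wordSum N (q + 1) f x = ∑ i, wordSum N q (N i f) x := by
  rw [wordSum, ← (Fin.consEquiv fun _ => ι).sum_comp, Fintype.sum_prod_type]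
  refine Finset.sum_congr rfl fun i _ => Finset.sum_congr rfl fun w _ => ?_
  rw [show (Fin.consEquiv fun _ => ι) (i, w) = Fin.cons i w from rfl, List.ofFn_succ]
  simp

theorem wordSum_add_le (N : ι → Module.End ℝ (ℝ → X)) (q : ℕ) (f g : ℝ → X) (x : ℝ) :
    wordSum N q (f + g) x ≤ wordSum N q f x + wordSum N q g x := by
  induction q generalizing f g with
  | zero => simpa [wordSum_zero] using norm_add_le (f x) (g x)
  | succ q ih =>
    simp only [wordSum_succ, map_add, ← Finset.sum_add_distrib]
    exact Finset.sum_le_sum fun i _ => ih _ _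

theorem wordSum_smul (N : ι → Module.End ℝ (ℝ → X)) (q : ℕ) (c : ℝ) (f : ℝ → X) (x : ℝ) :
    wordSum N q (c • f) x = |c| * wordSum N q f x := by
  induction q generalizing f with
  | zero => simp [wordSum_zero, norm_smul]
  | succ q ih => simp only [wordSum_succ, map_smul, ih, Finset.mul_sum]

end Words

section Counting

variable {E : Type*} [NormedAddCommGroup E] [InnerProductSpace ℂ E] {Γ K : ℕ}

/-- The operations of the commutator factor for globally defined Hamiltonians. -/
def wordOp (H : Fin Γ → ℝ → E →L[ℂ] E) : Option (Fin Γ) → Module.End ℝ (ℝ → E →L[ℂ] E)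
  | some g => adOp (H g)
  | none => (2 * Γ : ℝ) • derivEnd _

theorem wordOp_I_smul (H : Fin Γ → ℝ → E →L[ℂ] E) (o : Option (Fin Γ)) (f : ℝ → E →L[ℂ] E) :
    wordOp H o (Complex.I • f) = Complex.I • wordOp H o f := by
  cases o with
  | none =>
    simp only [wordOp, LinearMap.smul_apply, derivEnd_smul]
    rw [smul_comm]
  | some g =>
    ext1 x
    simp [wordOp, adOp, smul_sub]

/-- Removes the factor `i` in front of each commutator in `adGen`, since all word operations are
complex linear. -/
theorem wordSum_I_smul (H : Fin Γ → ℝ → E →L[ℂ] E) (q : ℕ) (f : ℝ → E →L[ℂ] E) (x : ℝ) :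
    wordSum (X := E →L[ℂ] E) (wordOp H) q (Complex.I • f) x = wordSum (X := E →L[ℂ] E) (wordOp H) q f x := by
  induction q generalizing f with
  | zero => simp [wordSum_zero, norm_smul]
  | succ q ih => simp only [wordSum_succ, wordOp_I_smul, ih]

theorem adOp_zero : adOp (0 : ℝ → E →L[ℂ] E) = 0 := by
  ext f x : 2
  simp [adOp]

namespace ProductFormula

theorem HasLayers.sum_factors {F : ProductFormula Γ K} {V : ℕ} (hV : F.HasLayers V)
    (φ : Fin Γ → ℝ) : (F.factors.map fun x => φ x.1).sum = V * ∑ g, φ g := by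
  rw [factors, List.map_ofFn, List.sum_ofFn, Finset.mul_sum,
    ← Finset.sum_fiberwise Finset.univ F.γ]
  refine Finset.sum_congr rfl fun g _ => ?_
  rw [Finset.sum_congr rfl (g := fun _ => φ g), Finset.sum_const, hV g, nsmul_eq_mul]
  intro k hk
  simp only [Finset.mem_filter] at hk
  simp [hk.2]

theorem HasLayers.sum_letters {F : ProductFormula Γ K} {V : ℕ} (hV : F.HasLayers V) (z : ℝ)
    (φ : Option (Fin Γ) → ℝ) :
    (((factorPath z F.factors).map Prod.fst).map φ).sum = V * ∑ g, (φ (some g) + φ none) := by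
  rw [← hV.sum_factors fun g => φ (some g) + φ none]
  generalize F.factors = L
  induction L with
  | nil => rfl
  | cons x L ih =>
    simp only [factorPath, List.map_cons, List.sum_cons, ih]
    ring

theorem HasLayers.one_le {F : ProductFormula Γ K} {V : ℕ} (hV : F.HasLayers V) : 1 ≤ V := by
  rw [← hV (F.γ ⟨0, F.K_pos⟩), Nat.one_le_iff_ne_zero, Finset.card_ne_zero]
  exact ⟨⟨0, F.K_pos⟩, by simp⟩

/-- Summed over the letters of the path, the generators split into `V` copies of each commutator and
`2 Γ V` derivatives, that is, `V` times the operations with weight `2 Γ` on the derivative. Each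
position in a word costs one factor `V`. -/
theorem HasLayers.listNorm_le {F : ProductFormula Γ K} {V : ℕ} (hV : F.HasLayers V)
    (H : Fin Γ → ℝ → E →L[ℂ] E) (z : ℝ) (q : ℕ) (f : ℝ → E →L[ℂ] E) (x : ℝ) :
    listNorm (X := E →L[ℂ] E) (fun o => adGen (letterHam 0 H o)) ((factorPath z F.factors).map Prod.fst) q f x ≤
      V ^ q * wordSum (X := E →L[ℂ] E) (wordOp H) q f x := by
  induction q generalizing f with
  | zero => simp [listNorm, wordSum_zero]
  | succ q ih =>
    rw [listNorm, hV.sum_letters]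
    have h1 : ∀ o, listNorm (X := E →L[ℂ] E) (fun o => adGen (letterHam 0 H o))
        ((factorPath z F.factors).map Prod.fst) q (adGen (letterHam 0 H o) f) x ≤
        V ^ q * (wordSum (X := E →L[ℂ] E) (wordOp H) q (derivEnd _ f) x +
          wordSum (X := E →L[ℂ] E) (wordOp H) q (adOp (letterHam 0 H o) f) x) := by
      intro o
      refine (ih _).trans (mul_le_mul_of_nonneg_left ?_ (by positivity))
      refine (wordSum_add_le _ _ _ _ _).trans ?_
      exact add_le_add le_rfl (wordSum_I_smul H q _ x).le
    have h0 : wordSum (X := E →L[ℂ] E) (wordOp H) q (adOp (letterHam 0 H none) f) x = 0 := by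
      rw [letterHam_none, adOp_zero, LinearMap.zero_apply]
      simpa using wordSum_smul (wordOp H) q 0 0 x
    rw [wordSum_succ, Fintype.sum_option]
    have h2 : wordSum (X := E →L[ℂ] E) (wordOp H) q (wordOp H none f) x =
        (2 * Γ : ℝ) * wordSum (X := E →L[ℂ] E) (wordOp H) q (derivEnd _ f) x := by
      rw [wordOp, LinearMap.smul_apply, wordSum_smul, abs_of_nonneg (by positivity)]
    rw [h2, pow_succ, mul_comm _ (V : ℝ), mul_assoc]
    refine mul_le_mul_of_nonneg_left ?_ (by positivity)
    refine (Finset.sum_le_sum fun g _ => add_le_add (h1 (some g)) (h1 none)).trans (le_of_eq ?_)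
    simp only [h0, letterHam_some, add_zero, Finset.sum_add_distrib, ← Finset.mul_sum,
      Finset.sum_const, Finset.card_univ, Fintype.card_fin, nsmul_eq_mul]
    simp only [wordOp]
    ring

end ProductFormula

end Counting

/-! ### Taylor remainders of the generator and of the Hamiltonian -/

section Remainder

variable {E : Type*} [NormedAddCommGroup E] [InnerProductSpace ℂ E] {Γ K : ℕ}

/-- The Taylor coefficients at `0` of the operator `factorGen`. -/
def factorCoeff (H : Fin Γ → ℝ → E →L[ℂ] E) (n : ℕ) : List (Fin Γ × ℝ × ℝ) → E →L[ℂ] E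
  | [] => 0
  | x :: L => factorCoeff H n L +
      (x.2.2 • chainPoly (fun o => adGen (letterHam 0 H o)) x.2.2
          ((none, nextStart 0 L) :: factorPath 0 L) n (H x.1) 0 -
        x.2.1 • chainPoly (fun o => adGen (letterHam 0 H o)) x.2.1
          (factorPath 0 (x :: L)) n (H x.1) 0)

variable [CompleteSpace E] [FiniteDimensional ℂ E]

theorem norm_factorGen_sub_le {q : ℕ} {H : Fin Γ → ℝ → E →L[ℂ] E}
    (hH : ∀ g, ContDiff ℝ (q + 1 : ℕ) (H g)) (hsa : ∀ g x, IsSelfAdjoint (H g x))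
    {B : Fin Γ → ℝ → ℝ} (hBc : ∀ g, Continuous (B g)) {s : ℝ} (hs : 0 ≤ s)
    (L : List (Fin Γ × ℝ × ℝ))
    (hL : ∀ x ∈ L, x.2.1 ∈ Icc (0 : ℝ) 1 ∧ x.2.2 ∈ Icc (0 : ℝ) 1)
    (hB : ∀ l, List.Sublist l ((factorPath 0 L).map Prod.fst) → ∀ g x,
      sortedNorm (X := E →L[ℂ] E) (fun o => adGen (letterHam 0 H o)) l (q + 1) (H g) x ≤ B g x) :
    ‖factorGen H s L - ∑ m ∈ Finset.range (q + 1), s ^ m • factorCoeff H m L‖ ≤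
      s ^ q * (L.map fun x => 2 * ∫ y in 0..s, B x.1 y).sum := by
  have hprop : ∀ o, IsPropagator (adProp (letterHam 0 H o)) (adGen (letterHam 0 H o)) q :=
    fun o => isPropagator_ad (letterHam_contDiff contDiff_const
      (fun g => (hH g).of_le (by exact_mod_cast Nat.le_succ q)) o)
      (letterHam_isSelfAdjoint (fun _ => IsSelfAdjoint.zero _) hsa o)
  -- One conjugated term costs one integral of the majorant, its prefactor `x₀` being at most `1`.
  -- Every factor has two such terms, whence the `2` in the bound.
  have hchain : ∀ (l : List (Option (Fin Γ) × ℝ)) (g : Fin Γ) (x₀ : ℝ),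
      x₀ ∈ Icc (0 : ℝ) 1 → (∀ y ∈ l, y.2 ∈ Icc (0 : ℝ) 1) → chainEnd x₀ l = 0 →
      List.Sublist (l.map Prod.fst) ((factorPath 0 L).map Prod.fst) →
      ‖x₀ • (chainVal (fun o => adProp (letterHam 0 H o)) s x₀ l (H g (x₀ * s)) -
        ∑ m ∈ Finset.range (q + 1),
          s ^ m • chainPoly (fun o => adGen (letterHam 0 H o)) x₀ l m (H g) 0)‖ ≤
        s ^ q * ∫ y in 0..s, B g y := by
    intro l g x₀ hx₀ hl hend hsub
    have h := norm_chainVal_sub_le hprop le_rfl (hH g) hs hx₀ l hl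
    rw [hend, zero_mul] at h
    rw [norm_smul, Real.norm_eq_abs, abs_of_nonneg hx₀.1]
    refine (mul_le_of_le_one_left (norm_nonneg _) hx₀.2).trans (h.trans ?_)
    refine mul_le_mul_of_nonneg_left ?_ (by positivity)
    exact intervalIntegral.integral_mono_on hs
      ((continuous_sortedNorm hprop _ le_rfl (hH g)).intervalIntegrable _ _)
      ((hBc g).intervalIntegrable _ _) fun x _ => hB _ hsub g x
  induction L with
  | nil => simp [factorGen, factorCoeff]
  | cons x L ih =>
    have hL' : ∀ x ∈ L, x.2.1 ∈ Icc (0 : ℝ) 1 ∧ x.2.2 ∈ Icc (0 : ℝ) 1 :=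
      fun y hy => hL y (by simp [hy])
    have hsub : List.Sublist ((factorPath 0 L).map Prod.fst)
        ((factorPath 0 (x :: L)).map Prod.fst) :=
      ((List.sublist_cons_self _ _).trans (List.sublist_cons_self _ _)).map _
    have ih' := ih hL' (fun l hl => hB l (hl.trans hsub))
      (fun l g x₀ h1 h2 h3 h4 => hchain l g x₀ h1 h2 h3 (h4.trans hsub))
    have hz : (0 : ℝ) ∈ Icc (0 : ℝ) 1 := by simp
    have hend := chainEnd_factorPath 0 L
    have hb := hchain ((none, nextStart 0 L) :: factorPath 0 L) x.1 x.2.2 (hL x (by simp)).2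
      (fun y hy => factorPath_mem hz hL y (List.mem_cons_of_mem _ hy)) hend
      ((List.sublist_cons_self _ _).map _)
    have ha := hchain (factorPath 0 (x :: L)) x.1 x.2.1 (hL x (by simp)).1
      (factorPath_mem hz hL) (chainEnd_factorPath 0 (x :: L)) (List.Sublist.refl _)
    rw [List.map_cons, List.sum_cons]
    have hsplit : ∀ (Q Q' b b' a a' : E →L[ℂ] E) (xb xa : ℝ),
        Q + (xb • b - xa • a) - (Q' + (xb • b' - xa • a')) =
          (Q - Q') + (xb • (b - b') - xa • (a - a')) := by
      intros
      simp only [smul_sub]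
      abel
    have hsum : ∑ m ∈ Finset.range (q + 1), s ^ m • factorCoeff H m (x :: L) =
        ∑ m ∈ Finset.range (q + 1), s ^ m • factorCoeff H m L +
        (x.2.2 • ∑ m ∈ Finset.range (q + 1), s ^ m • chainPoly
            (fun o => adGen (letterHam 0 H o)) x.2.2
            ((none, nextStart 0 L) :: factorPath 0 L) m (H x.1) 0 -
          x.2.1 • ∑ m ∈ Finset.range (q + 1), s ^ m • chainPoly
            (fun o => adGen (letterHam 0 H o)) x.2.1 (factorPath 0 (x :: L)) m (H x.1) 0) := by
      simp only [factorCoeff, smul_add, smul_sub, Finset.sum_add_distrib, Finset.sum_sub_distrib,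
        Finset.smul_sum, smul_comm x.2.2, smul_comm x.2.1]
    rw [hsum, factorGen, hsplit]
    refine (norm_add_le _ _).trans ?_
    refine (add_le_add ih' ((norm_sub_le _ _).trans (add_le_add hb ha))).trans (le_of_eq ?_)
    ring

/-- The Taylor coefficients at `0` of the sum of the Hamiltonians. -/
def sumCoeff (H : Fin Γ → ℝ → E →L[ℂ] E) (n : ℕ) : E →L[ℂ] E :=
  ∑ g, chainPoly (fun o => adGen (letterHam 0 H o)) 1 [(none, 0)] n (H g) 0

theorem norm_sum_sub_le {q : ℕ} {H : Fin Γ → ℝ → E →L[ℂ] E}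
    (hH : ∀ g, ContDiff ℝ (q + 1 : ℕ) (H g)) (hsa : ∀ g x, IsSelfAdjoint (H g x))
    {B : Fin Γ → ℝ → ℝ} (hBc : ∀ g, Continuous (B g)) {s : ℝ} (hs : 0 ≤ s)
    (hB : ∀ g x, sortedNorm (X := E →L[ℂ] E) (fun o => adGen (letterHam 0 H o)) [none] (q + 1) (H g) x ≤ B g x) :
    ‖∑ g, H g s - ∑ m ∈ Finset.range (q + 1), s ^ m • sumCoeff H m‖ ≤
      s ^ q * ∑ g, ∫ y in 0..s, B g y := by
  have hprop : ∀ o, IsPropagator (adProp (letterHam 0 H o)) (adGen (letterHam 0 H o)) q :=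
    fun o => isPropagator_ad (letterHam_contDiff contDiff_const
      (fun g => (hH g).of_le (by exact_mod_cast Nat.le_succ q)) o)
      (letterHam_isSelfAdjoint (fun _ => IsSelfAdjoint.zero _) hsa o)
  have hsum : ∑ m ∈ Finset.range (q + 1), s ^ m • sumCoeff H m =
      ∑ g, ∑ m ∈ Finset.range (q + 1), s ^ m •
        chainPoly (fun o => adGen (letterHam 0 H o)) 1 [(none, 0)] m (H g) 0 := by
    simp only [sumCoeff, Finset.smul_sum]
    exact Finset.sum_comm
  rw [hsum, ← Finset.sum_sub_distrib, Finset.mul_sum]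
  refine (norm_sum_le _ _).trans (Finset.sum_le_sum fun g _ => ?_)
  -- Ordinary Taylor expansion at `0`, seen as a path with a single shift from time `s` to `0`.
  have h := norm_chainVal_sub_le hprop le_rfl (hH g) hs (x₀ := 1) (by simp) [(none, 0)] (by simp)
  simp only [chainVal, chainEnd, zero_mul, one_mul, LinearMap.id_comp] at h
  have h1 : adProp (letterHam 0 H none) 0 s (H g s) = H g s := by
    simp [adProp, letterHam_none, timeEvolution_zero]
  rw [h1] at h
  refine h.trans (mul_le_mul_of_nonneg_left ?_ (by positivity))
  exact intervalIntegral.integral_mono_on hs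
    ((continuous_sortedNorm hprop _ le_rfl (hH g)).intervalIntegrable _ _)
    ((hBc g).intervalIntegrable _ _) fun x _ => hB g x

end Remainder

end TimeDepPF
end

/-! ### Passage between the interval and the whole line -/

noncomputable section

namespace TimeDepPF

section Transfer

variable {E : Type*} [NormedAddCommGroup E] [InnerProductSpace ℂ E] {Γ : ℕ}

theorem contDiff_wordOp {n : ℕ} {H : Fin Γ → ℝ → E →L[ℂ] E} (hH : ∀ g, ContDiff ℝ n (H g))
    (o : Option (Fin Γ)) {m : ℕ} (hm : m ≤ n) {f : ℝ → E →L[ℂ] E}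
    (hf : ContDiff ℝ (m + 1 : ℕ) f) : ContDiff ℝ m (wordOp H o f) := by
  cases o with
  | none => exact (contDiff_derivEnd hf).const_smul (2 * Γ : ℝ)
  | some g =>
    exact contDiff_adOp ((hH g).of_le (by exact_mod_cast hm))
      (hf.of_le (by exact_mod_cast Nat.le_succ m))

theorem contDiff_foldl_wordOp {n : ℕ} {H : Fin Γ → ℝ → E →L[ℂ] E}
    (hH : ∀ g, ContDiff ℝ n (H g)) (w : List (Option (Fin Γ))) (hw : w.length ≤ n)
    {f : ℝ → E →L[ℂ] E} (hf : ContDiff ℝ w.length f) :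
    Continuous (w.foldl (fun f i => wordOp H i f) f) := by
  induction w generalizing f with
  | nil => exact hf.continuous
  | cons o w ih =>
    rw [List.length_cons] at hw
    exact ih (by omega) (contDiff_wordOp hH o (by omega) hf)

theorem foldl_nestedOp_eqOn {n : ℕ} {t : ℝ} (ht : 0 < t) {H H' : Fin Γ → ℝ → E →L[ℂ] E}
    (hH' : ∀ g, ContDiff ℝ n (H' g)) (h : ∀ g, EqOn (H g) (H' g) (Icc 0 t))
    (w : List (Option (Fin Γ))) (hw : w.length ≤ n) {f f' : ℝ → E →L[ℂ] E}
    (hf' : ContDiff ℝ w.length f') (hf : EqOn f f' (Icc 0 t)) :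
    EqOn (w.foldl (fun X i => nestedOp H t i X) f) (w.foldl (fun f i => wordOp H' i f) f')
      (Icc 0 t) := by
  induction w generalizing f f' with
  | nil => exact hf
  | cons o w ih =>
    rw [List.length_cons] at hw
    refine ih (by omega) (contDiff_wordOp hH' o (by omega) hf') ?_
    intro x hx
    have hd : Differentiable ℝ f' := hf'.differentiable (by simp)
    cases o with
    | none =>
      have h1 : derivWithin f (Icc 0 t) x = deriv f' x := by
        rw [derivWithin_congr hf (hf hx)]
        exact (hd x).derivWithin (uniqueDiffOn_Icc ht x hx)
      simp only [nestedOp, wordOp, LinearMap.smul_apply, derivEnd_apply hd, Pi.smul_apply, h1]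
    | some g => simp only [nestedOp, wordOp, adOp, LinearMap.coe_mk, AddHom.coe_mk, h g hx, hf hx]

theorem alphaCom_eq {p : ℕ} {t : ℝ} (ht : 0 < t) {H H' : Fin Γ → ℝ → E →L[ℂ] E}
    (hH' : ∀ g, ContDiff ℝ p (H' g)) (h : ∀ g, EqOn (H g) (H' g) (Icc 0 t)) {τ : ℝ}
    (hτ : τ ∈ Icc 0 t) :
    alphaCom H t p τ = ∑ g, wordSum (X := E →L[ℂ] E) (wordOp H') p (H' g) τ := by
  simp only [alphaCom, wordSum]
  rw [Finset.sum_comm]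
  refine Finset.sum_congr rfl fun g _ => Finset.sum_congr rfl fun w _ => ?_
  congr 1
  exact foldl_nestedOp_eqOn ht hH' h (List.ofFn w) (by simp) (by simpa using hH' g) (h g) hτ

theorem continuous_wordSum {p : ℕ} {H : Fin Γ → ℝ → E →L[ℂ] E}
    (hH : ∀ g, ContDiff ℝ p (H g)) (g : Fin Γ) :
    Continuous (wordSum (X := E →L[ℂ] E) (wordOp H) p (H g)) := by
  refine continuous_finsetSum _ fun w _ => Continuous.norm ?_
  exact contDiff_foldl_wordOp hH (List.ofFn w) (by simp) (by simpa using hH g)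

theorem ProductFormula.S_congr {K : ℕ} (F : ProductFormula Γ K) {t : ℝ}
    {H H' : Fin Γ → ℝ → E →L[ℂ] E} (h : ∀ g, EqOn (H g) (H' g) (Icc 0 t)) {s : ℝ}
    (hs : s ∈ Icc 0 t) : F.S H s = F.S H' s := by
  rw [S, S]
  congr 3
  ext1 k
  have hmul : ∀ c ∈ Icc (0 : ℝ) 1, c * s ∈ Icc 0 t := fun c hc =>
    ⟨mul_nonneg hc.1 hs.1, (mul_le_of_le_one_left hs.1 hc.2).trans hs.2⟩
  refine timeEvolution_congr (h _) (hmul _ (F.β_mem k)) ?_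
  rw [← add_mul]
  exact hmul _ (F.β_add_α_mem k)

/-- The self-adjoint part of any extension is still an extension. -/
theorem exists_contDiff_isSelfAdjoint_eqOn_Icc [CompleteSpace E] {t : ℝ} (ht : 0 < t) (n : ℕ)
    {f : ℝ → E →L[ℂ] E} (hf : ContDiffOn ℝ n f (Icc 0 t))
    (hsa : ∀ x ∈ Icc 0 t, IsSelfAdjoint (f x)) :
    ∃ g : ℝ → E →L[ℂ] E, ContDiff ℝ n g ∧ (∀ x, IsSelfAdjoint (g x)) ∧ EqOn f g (Icc 0 t) := by
  obtain ⟨g, hg, hfg⟩ := exists_contDiff_eqOn_Icc ht n hf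
  refine ⟨fun x => (1 / 2 : ℂ) • (g x + star (g x)), ?_, fun x => ?_, fun x hx => ?_⟩
  · have hstar : ContDiff ℝ n fun x => star (g x) :=
      (AddMonoidHom.toRealLinearMap (starAddEquiv : (E →L[ℂ] E) ≃+ (E →L[ℂ] E)).toAddMonoidHom
        continuous_star).contDiff.comp hg
    exact (hg.add hstar).const_smul (1 / 2 : ℂ)
  · have h2 : IsSelfAdjoint (1 / 2 : ℂ) := by simp [isSelfAdjoint_iff]
    exact h2.smul (IsSelfAdjoint.add_star_self (g x))
  · have h1 := hsa x hx
    rw [hfg hx] at h1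
    simp only [h1.star_eq, hfg hx]
    rw [← two_smul ℂ (g x), smul_smul]
    norm_num

end Transfer

/-! ### Vanishing of the low-order coefficients -/

section Vanishing

variable {X : Type*} [NormedAddCommGroup X] [NormedSpace ℝ X]

theorem isBigO_of_hasDerivAt {y y' : ℝ → X} (hy : ∀ s, HasDerivAt y (y' s) s) (h0 : y 0 = 0)
    {k : ℕ} (h : y' =O[𝓝[>] 0] fun s => s ^ k) : y =O[𝓝[>] 0] fun s => s ^ (k + 1) := by
  obtain ⟨C, hC0, hC⟩ := h.exists_pos
  rw [IsBigOWith, eventually_nhdsWithin_iff, Metric.eventually_nhds_iff] at hC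
  obtain ⟨δ, hδ, hC⟩ := hC
  refine IsBigO.of_bound C ?_
  filter_upwards [Ioo_mem_nhdsGT hδ] with s hs
  have hpos : ∀ x ∈ Ioc (0 : ℝ) s, ‖y' x‖ ≤ C * s ^ k := fun x hx => by
    refine (hC (by rw [Real.dist_eq, sub_zero, abs_of_pos hx.1]; exact hx.2.trans_lt hs.2)
      hx.1).trans ?_
    rw [Real.norm_eq_abs, abs_of_nonneg (pow_nonneg hx.1.le k)]
    have := hx.1.le
    gcongr
    exact hx.2
  -- The derivative is controlled only at positive times, so the estimate starts at `ε` and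
  -- continuity of `y` at `0` finishes it.
  have hle : ∀ ε ∈ Ioc (0 : ℝ) s, ‖y s - y ε‖ ≤ C * s ^ (k + 1) := fun ε hε => by
    have h1 := (convex_Ioc 0 s).norm_image_sub_le_of_norm_hasDerivWithin_le
      (fun x _ => (hy x).hasDerivWithinAt) hpos hε (right_mem_Ioc.2 hs.1)
    rw [Real.norm_eq_abs, abs_of_nonneg (sub_nonneg.2 hε.2)] at h1
    refine h1.trans ?_
    rw [pow_succ, ← mul_assoc]
    exact mul_le_mul_of_nonneg_left (by linarith [hε.1])
      (mul_nonneg hC0.le (pow_nonneg hs.1.le k))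
  have hlim : Tendsto (fun ε => ‖y s - y ε‖) (𝓝[>] 0) (𝓝 ‖y s - y 0‖) :=
    ((tendsto_const_nhds.sub (hy 0).continuousAt).norm).mono_left nhdsWithin_le_nhds
  rw [h0, sub_zero] at hlim
  rw [Real.norm_eq_abs, abs_of_nonneg (pow_nonneg hs.1.le _)]
  exact le_of_tendsto hlim (eventually_of_mem (Ioc_mem_nhdsGT hs.1) hle)

theorem isBigO_pow_pow {a b : ℕ} (h : b ≤ a) :
    (fun s : ℝ => s ^ a) =O[𝓝[>] 0] fun s => s ^ b := by
  refine IsBigO.of_bound 1 ?_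
  filter_upwards [Ioo_mem_nhdsGT one_pos] with s hs
  rw [one_mul, norm_pow, norm_pow, Real.norm_eq_abs, abs_of_pos hs.1]
  exact pow_le_pow_of_le_one hs.1.le hs.2.le h

end Vanishing

section Vanishing'

variable {E : Type*} [NormedAddCommGroup E] [InnerProductSpace ℂ E]

/-- If all coefficients before `r m` vanish, then `W' = s^m r m + O(s^(m+1))`, as the outer factors
are `1 + O(s)`. Integration gives `W - W 0` the leading term `s^(m+1) r m / (m+1)`, which the
assumed order excludes unless `r m = 0`. -/
theorem coeff_eq_zero_of_hasDerivAt {p : ℕ} {W l ρ R : ℝ → E →L[ℂ] E} {r : ℕ → E →L[ℂ] E}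
    (hW : ∀ s, HasDerivAt W (l s * R s * ρ s) s)
    (hl : (fun s => l s - 1) =O[𝓝[>] 0] fun s : ℝ => s)
    (hρ : (fun s => ρ s - 1) =O[𝓝[>] 0] fun s : ℝ => s)
    (hR : (fun s => R s - ∑ m ∈ Finset.range p, s ^ m • r m) =O[𝓝[>] 0] fun s => s ^ p)
    (hW0 : (fun s => W s - W 0) =O[𝓝[>] 0] fun s => s ^ (p + 1)) :
    ∀ m < p, r m = 0 := by
  have hone : ∀ {k : ℝ → E →L[ℂ] E}, (fun s => k s - 1) =O[𝓝[>] 0] (fun s : ℝ => s) →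
      k =O[𝓝[>] 0] fun _ : ℝ => (1 : ℝ) := by
    intro k hk
    have h1 : (fun s : ℝ => s) =O[𝓝[>] 0] fun _ : ℝ => (1 : ℝ) := by
      simpa using isBigO_pow_pow (Nat.zero_le 1)
    have h2 := (hk.trans h1).add (isBigO_const_const (1 : E →L[ℂ] E) (one_ne_zero (α := ℝ)) _)
    simpa using h2
  intro m
  induction m using Nat.strong_induction_on with
  | _ m ih =>
    intro hm
    have hterm : ∀ j ∈ Finset.range p,
        (fun s : ℝ => if j = m then 0 else s ^ j • r j) =O[𝓝[>] 0] fun s => s ^ (m + 1) := by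
      intro j hj
      rw [Finset.mem_range] at hj
      rcases lt_trichotomy j m with h | h | h
      · simp [ih j h hj, isBigO_zero]
      · simp [h, isBigO_zero]
      · simp only [h.ne', if_false]
        simpa using (isBigO_pow_pow (show m + 1 ≤ j from h)).smul
          (isBigO_const_const (r j) (one_ne_zero (α := ℝ)) _)
    have hRm : (fun s => R s - s ^ m • r m) =O[𝓝[>] 0] fun s => s ^ (m + 1) := by
      refine ((hR.trans (isBigO_pow_pow hm)).add (IsBigO.sum hterm)).congr_left fun s => ?_
      have : ∑ j ∈ Finset.range p, s ^ j • r j =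
          ∑ j ∈ Finset.range p, (if j = m then 0 else s ^ j • r j) + s ^ m • r m := by
        have h1 : ∀ j ∈ Finset.range p, s ^ j • r j =
            (if j = m then 0 else s ^ j • r j) + if j = m then s ^ j • r j else 0 := fun j _ => by
          split_ifs <;> simp
        rw [Finset.sum_congr rfl h1, Finset.sum_add_distrib, Finset.sum_ite_eq',
          if_pos (Finset.mem_range.2 hm)]
      rw [this, Finset.sum_apply]
      abel
    have hG : (fun s => l s * R s * ρ s - s ^ m • r m) =O[𝓝[>] 0] fun s => s ^ (m + 1) := by
      have h1 : (fun s => l s * (R s - s ^ m • r m) * ρ s) =O[𝓝[>] 0] fun s => s ^ (m + 1) := by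
        simpa using ((hone hl).mul hRm).mul (hone hρ)
      have hr : (fun _ : ℝ => r m) =O[𝓝[>] 0] fun _ : ℝ => (1 : ℝ) :=
        isBigO_const_const _ one_ne_zero _
      have h2 : (fun s => s ^ m • ((l s - 1) * r m * ρ s + r m * (ρ s - 1))) =O[𝓝[>] 0]
          fun s => s ^ (m + 1) := by
        have h3 : (fun s => (l s - 1) * r m * ρ s + r m * (ρ s - 1)) =O[𝓝[>] 0]
            fun s : ℝ => s := by
          refine IsBigO.add ?_ ?_
          · simpa using (hl.mul hr).mul (hone hρ)
          · simpa using hr.mul hρ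
        simpa [pow_succ] using (isBigO_refl (fun s : ℝ => s ^ m) _).smul h3
      refine (h1.add h2).congr_left fun s => ?_
      simp only [mul_sub, sub_mul, smul_add, smul_sub, mul_smul_comm, smul_mul_assoc, mul_one,
        one_mul]
      abel
    have hy : ∀ s, HasDerivAt (fun s => W s - W 0 - (s ^ (m + 1) / ((m + 1 : ℕ) : ℝ)) • r m)
        (l s * R s * ρ s - s ^ m • r m) s := by
      intro s
      have h1 : HasDerivAt (fun s : ℝ => s ^ (m + 1) / ((m + 1 : ℕ) : ℝ)) (s ^ m) s := by
        have := (hasDerivAt_pow (m + 1) s).div_const ((m + 1 : ℕ) : ℝ)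
        refine this.congr_deriv ?_
        rw [Nat.add_sub_cancel, mul_div_assoc, mul_div_cancel₀]
        exact_mod_cast Nat.succ_ne_zero m
      exact ((hW s).sub_const _).sub (h1.smul_const (r m))
    have hyO := isBigO_of_hasDerivAt hy (by simp) hG
    have hfin : (fun s : ℝ => (s ^ (m + 1) / ((m + 1 : ℕ) : ℝ)) • r m) =O[𝓝[>] 0]
        fun s => s ^ (m + 2) :=
      ((hW0.trans (isBigO_pow_pow (show m + 2 ≤ p + 1 by omega))).sub hyO).congr_left
        fun s => by abel
    have hcoeff := coeff_eq_zero_of_isBigO (m + 2)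
      (fun j => if j = m + 1 then ((m + 1 : ℕ) : ℝ)⁻¹ • r m else 0)
      (hfin.congr_left fun s => by
        rw [Finset.sum_eq_single (m + 1)]
        · rw [if_pos rfl, smul_smul, div_eq_mul_inv]
        · intro j _ hj
          rw [if_neg hj, smul_zero]
        · simp) (m + 1) (by omega)
    rw [if_pos rfl, smul_eq_zero] at hcoeff
    refine hcoeff.resolve_left (inv_ne_zero ?_)
    exact_mod_cast Nat.succ_ne_zero m

end Vanishing'

end TimeDepPF
end

/-! ### The error bound -/

noncomputable section

namespace TimeDepPF

section Bound

variable {E : Type*} [NormedAddCommGroup E] [InnerProductSpace ℂ E] {Γ K : ℕ}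

theorem factorProd_zero (H : Fin Γ → ℝ → E →L[ℂ] E) (L : List (Fin Γ × ℝ × ℝ)) :
    factorProd H 0 L = 1 := by
  induction L with
  | nil => rfl
  | cons x L ih => simp [factorProd, ih, timeEvolution_self]

theorem ProductFormula.S_zero (F : ProductFormula Γ K) (H : Fin Γ → ℝ → E →L[ℂ] E) :
    F.S H 0 = 1 := by
  rw [F.S_eq_factorProd, factorProd_zero]

variable [CompleteSpace E] [FiniteDimensional ℂ E]

omit [FiniteDimensional ℂ E] in
theorem norm_factorProd_le {H : Fin Γ → ℝ → E →L[ℂ] E} (hH : ∀ g, Continuous (H g))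
    (hsa : ∀ g x, IsSelfAdjoint (H g x)) (s : ℝ) (L : List (Fin Γ × ℝ × ℝ)) :
    ‖factorProd H s L‖ ≤ 1 := by
  induction L with
  | nil => exact (ContinuousLinearMap.norm_id_le : ‖ContinuousLinearMap.id ℂ E‖ ≤ 1)
  | cons x L ih =>
    exact (norm_mul_le _ _).trans (mul_le_one₀ ih (norm_nonneg _)
      (norm_timeEvolution_le (hH x.1) (hsa x.1) _ _))

theorem norm_factorGen_sub_sum_sub_le {q V : ℕ} {F : ProductFormula Γ K} (hV : F.HasLayers V)
    {H : Fin Γ → ℝ → E →L[ℂ] E}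
    (hH : ∀ g, ContDiff ℝ (q + 1 : ℕ) (H g)) (hsa : ∀ g x, IsSelfAdjoint (H g x)) {t M : ℝ}
    (hM : ∀ τ ∈ Icc 0 t, ∑ g, wordSum (X := E →L[ℂ] E) (wordOp H) (q + 1) (H g) τ ≤ M) {s : ℝ}
    (hs : s ∈ Icc 0 t) :
    ‖factorGen H s F.factors - ∑ g, H g s - ∑ m ∈ Finset.range (q + 1),
      s ^ m • (factorCoeff H m F.factors - sumCoeff H m)‖ ≤ 3 * V ^ (q + 2) * M * s ^ (q + 1) := by
  set B : Fin Γ → ℝ → ℝ := fun g x =>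
    V ^ (q + 1) * wordSum (X := E →L[ℂ] E) (wordOp H) (q + 1) (H g) x with hBdef
  have hBc : ∀ g, Continuous (B g) := fun g =>
    continuous_const.mul (continuous_wordSum hH g)
  have hB : ∀ l, List.Sublist l ((factorPath 0 F.factors).map Prod.fst) → ∀ g x,
      sortedNorm (X := E →L[ℂ] E) (fun o => adGen (letterHam 0 H o)) l (q + 1) (H g) x ≤ B g x :=
    fun l hl g x => (sortedNorm_le_listNorm _ hl _ _ _).trans (hV.listNorm_le H 0 (q + 1) (H g) x)
  have hnone : List.Sublist [none] ((factorPath 0 F.factors).map Prod.fst) := by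
    rw [List.singleton_sublist]
    have hne : F.factors ≠ [] := by
      intro h
      have := congrArg List.length h
      rw [ProductFormula.factors, List.length_ofFn] at this
      exact F.K_pos.ne' this
    obtain ⟨x, L, hL⟩ := List.exists_cons_of_ne_nil hne
    simp [hL, factorPath]
  have h1 := norm_factorGen_sub_le hH hsa hBc hs.1 F.factors (fun x hx => F.mem_factors hx) hB
  have h2 := norm_sum_sub_le hH hsa hBc hs.1 (hB _ hnone)
  rw [hV.sum_factors fun g => 2 * ∫ y in 0..s, B g y, ← Finset.mul_sum] at h1
  have hI : ∑ g, ∫ y in 0..s, B g y ≤ V ^ (q + 1) * M * s := by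
    rw [← intervalIntegral.integral_finsetSum fun g _ => (hBc g).intervalIntegrable _ _]
    have h3 : ∫ y in 0..s, ∑ g, B g y ≤ ∫ _ in 0..s, (V ^ (q + 1) * M : ℝ) := by
      refine intervalIntegral.integral_mono_on hs.1
        ((continuous_finsetSum _ fun g _ => hBc g).intervalIntegrable _ _)
        (continuous_const.intervalIntegrable _ _) fun x hx => ?_
      rw [hBdef]
      simp only [← Finset.mul_sum]
      exact mul_le_mul_of_nonneg_left (hM x ⟨hx.1, hx.2.trans hs.2⟩) (by positivity)
    refine h3.trans (le_of_eq ?_)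
    rw [intervalIntegral.integral_const, sub_zero, smul_eq_mul]
    ring
  have hI0 : 0 ≤ ∑ g, ∫ y in 0..s, B g y :=
    Finset.sum_nonneg fun g _ => intervalIntegral.integral_nonneg hs.1 fun x _ =>
      mul_nonneg (by positivity) (Finset.sum_nonneg fun _ _ => norm_nonneg _)
  have hV1 : (1 : ℝ) ≤ V := by exact_mod_cast hV.one_le
  have hs0 := hs.1
  have hsplit : factorGen H s F.factors - ∑ g, H g s - ∑ m ∈ Finset.range (q + 1),
      s ^ m • (factorCoeff H m F.factors - sumCoeff H m) =
      (factorGen H s F.factors - ∑ m ∈ Finset.range (q + 1), s ^ m • factorCoeff H m F.factors) -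
      (∑ g, H g s - ∑ m ∈ Finset.range (q + 1), s ^ m • sumCoeff H m) := by
    simp only [smul_sub, Finset.sum_sub_distrib]
    abel
  rw [hsplit]
  refine (norm_sub_le _ _).trans ((add_le_add h1 h2).trans ?_)
  -- The constant `3` arises here: `2 V` from the two ends of all factors, `1` from the Hamiltonian,
  -- and `1 ≤ V`.
  calc s ^ q * (V * (2 * ∑ g, ∫ y in 0..s, B g y)) + s ^ q * ∑ g, ∫ y in 0..s, B g y
      = s ^ q * ((2 * V + 1) * ∑ g, ∫ y in 0..s, B g y) := by ring
    _ ≤ s ^ q * ((3 * V) * (V ^ (q + 1) * M * s)) := by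
        refine mul_le_mul_of_nonneg_left ?_ (by positivity)
        exact mul_le_mul (by linarith) hI hI0 (by positivity)
    _ = 3 * V ^ (q + 2) * M * s ^ (q + 1) := by ring

theorem hasDerivAt_star_timeEvolution_mul_factorProd {H : Fin Γ → ℝ → E →L[ℂ] E}
    (hH : ∀ g, Continuous (H g)) (hsa : ∀ g x, IsSelfAdjoint (H g x))
    (L : List (Fin Γ × ℝ × ℝ)) (s : ℝ) :
    HasDerivAt (fun s => star (timeEvolution (fun x => ∑ g, H g x) s 0) * factorProd H s L)
      (star (timeEvolution (fun x => ∑ g, H g x) s 0) *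
        (-Complex.I • (factorGen H s L - ∑ g, H g s)) * factorProd H s L) s := by
  have hc : Continuous fun x => ∑ g, H g x := continuous_finsetSum _ fun g _ => hH g
  have hs : IsSelfAdjoint (∑ g, H g s) := isSelfAdjoint_sum _ fun g _ => hsa g s
  refine ((hasDerivAt_timeEvolution hc 0 s).star.mul
    (hasDerivAt_factorProd hH hsa s L)).congr_deriv ?_
  rw [star_smul, star_mul, hs.star_eq]
  simp only [star_neg, Complex.star_def, Complex.conj_I, neg_neg, smul_mul_assoc, mul_smul_comm,
    mul_sub, sub_mul, smul_sub, neg_smul, mul_assoc, neg_mul, mul_neg]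
  abel

/-- Here `p = q + 1`. The remainder estimate is used twice: near `0` to see that the Taylor
coefficients vanish, and then on all of `[0, t]` to bound the derivative of `U† S`. -/
theorem norm_timeEvolution_sub_S_le {q V : ℕ} {F : ProductFormula Γ K} (hV : F.HasLayers V)
    {H : Fin Γ → ℝ → E →L[ℂ] E}
    (hH : ∀ g, ContDiff ℝ (q + 1 : ℕ) (H g)) (hsa : ∀ g x, IsSelfAdjoint (H g x)) {t M : ℝ}
    (ht : 0 < t)
    (hM : ∀ τ ∈ Icc 0 t, ∑ g, wordSum (X := E →L[ℂ] E) (wordOp H) (q + 1) (H g) τ ≤ M)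
    (hord : F.HasOrderFor H (q + 1)) :
    ‖timeEvolution (fun x => ∑ g, H g x) t 0 - F.S H t‖ ≤
      3 * V ^ (q + 2) * M * t ^ (q + 2) := by
  have hHc : ∀ g, Continuous (H g) := fun g => (hH g).continuous
  have hc : Continuous fun x => ∑ g, H g x := continuous_finsetSum _ fun g _ => hHc g
  have hsas : ∀ x, IsSelfAdjoint (∑ g, H g x) := fun x => isSelfAdjoint_sum _ fun g _ => hsa g x
  set U : ℝ → E →L[ℂ] E := fun s => timeEvolution (fun x => ∑ g, H g x) s 0 with hU
  set S : ℝ → E →L[ℂ] E := fun s => factorProd H s F.factors with hS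
  set R : ℝ → E →L[ℂ] E := fun s =>
    -Complex.I • (factorGen H s F.factors - ∑ g, H g s) with hR
  set r : ℕ → E →L[ℂ] E := fun m =>
    -Complex.I • (factorCoeff H m F.factors - sumCoeff H m) with hr
  have hW : ∀ s, HasDerivAt (fun s => star (U s) * S s) (star (U s) * R s * S s) s := fun s =>
    hasDerivAt_star_timeEvolution_mul_factorProd hHc hsa F.factors s
  have hU0 : U 0 = 1 := timeEvolution_self _ 0
  have hS0 : S 0 = 1 := factorProd_zero H F.factors
  have hUn : ∀ s, ‖star (U s)‖ ≤ 1 := fun s => by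
    rw [norm_star]; exact norm_timeEvolution_le hc hsas s 0
  have hSn : ∀ s, ‖S s‖ ≤ 1 := fun s => norm_factorProd_le hHc hsa s F.factors
  have hrem : ∀ s ∈ Icc 0 t, ‖R s - ∑ m ∈ Finset.range (q + 1), s ^ m • r m‖ ≤
      3 * V ^ (q + 2) * M * s ^ (q + 1) := by
    intro s hs
    have h := norm_factorGen_sub_sum_sub_le hV hH hsa hM hs
    have : R s - ∑ m ∈ Finset.range (q + 1), s ^ m • r m =
        -Complex.I • (factorGen H s F.factors - ∑ g, H g s - ∑ m ∈ Finset.range (q + 1),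
          s ^ m • (factorCoeff H m F.factors - sumCoeff H m)) := by
      rw [smul_sub, Finset.smul_sum]
      simp only [hR, hr, smul_comm _ (-Complex.I)]
    rwa [this, norm_smul, norm_neg, Complex.norm_I, one_mul]
  have hev : ∀ᶠ s in 𝓝[>] (0 : ℝ), s ∈ Icc 0 t := by
    filter_upwards [Ioc_mem_nhdsGT ht] with s hs
    exact ⟨hs.1.le, hs.2⟩
  have hr0 : ∀ m < q + 1, r m = 0 := by
    refine coeff_eq_zero_of_hasDerivAt hW ?_ ?_ ?_ ?_
    · have := (hasDerivAt_timeEvolution hc 0 0).star.isBigO_sub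
      simp only [sub_zero, timeEvolution_self, star_one] at this
      exact this.mono nhdsWithin_le_nhds
    · have := (hasDerivAt_factorProd hHc hsa 0 F.factors).isBigO_sub
      simp only [sub_zero, factorProd_zero] at this
      exact this.mono nhdsWithin_le_nhds
    · refine IsBigO.of_bound (3 * V ^ (q + 2) * M) ?_
      filter_upwards [hev] with s hs
      rw [Real.norm_eq_abs, abs_of_nonneg (pow_nonneg hs.1 _)]
      exact hrem s hs
    · refine IsBigO.trans (IsBigO.of_bound 1 (Eventually.of_forall fun s => ?_)) hord
      rw [F.S_eq_factorProd, one_mul]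
      have : star (U s) * S s - star (U 0) * S 0 = -(star (U s) * (U s - S s)) := by
        rw [mul_sub, star_timeEvolution_mul_self hc hsas, hU0, hS0, star_one, one_mul]
        abel
      rw [this, norm_neg]
      exact (norm_mul_le _ _).trans (mul_le_of_le_one_left (norm_nonneg _) (hUn s))
  have hRb : ∀ s ∈ Icc 0 t, ‖star (U s) * R s * S s‖ ≤ 3 * V ^ (q + 2) * M * t ^ (q + 1) := by
    intro s hs
    have h1 : ‖R s‖ ≤ 3 * V ^ (q + 2) * M * s ^ (q + 1) := by
      have := hrem s hs
      rwa [Finset.sum_eq_zero fun m hm => by rw [hr0 m (Finset.mem_range.1 hm), smul_zero],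
        sub_zero] at this
    have hM0 : 0 ≤ M := (Finset.sum_nonneg fun g _ => Finset.sum_nonneg fun _ _ =>
      norm_nonneg _).trans (hM 0 ⟨le_rfl, ht.le⟩)
    refine (norm_mul_le _ _).trans ((mul_le_of_le_one_right (norm_nonneg _) (hSn s)).trans ?_)
    refine (norm_mul_le _ _).trans ((mul_le_of_le_one_left (norm_nonneg _) (hUn s)).trans ?_)
    refine h1.trans ?_
    have := hs.1
    gcongr
    exact hs.2
  have hfin := norm_image_sub_le_of_norm_deriv_le_segment' (a := 0) (b := t)
    (fun s _ => (hW s).hasDerivWithinAt) (fun s hs => hRb s (Ico_subset_Icc_self hs)) t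
    (right_mem_Icc.2 ht.le)
  have hsub : U t - S t = -(U t * (star (U t) * S t - star (U 0) * S 0)) := by
    rw [mul_sub, ← mul_assoc, timeEvolution_mul_star_self hc hsas, hU0, hS0, star_one]
    simp
  rw [F.S_eq_factorProd]
  change ‖U t - S t‖ ≤ _
  rw [hsub, norm_neg]
  refine (norm_mul_le _ _).trans ((mul_le_of_le_one_left (norm_nonneg _)
    (norm_timeEvolution_le hc hsas t 0)).trans (hfin.trans (le_of_eq ?_)))
  ring

end Bound

end TimeDepPF
end

theorem mainTheorem2 {E : Type*} [NormedAddCommGroup E] [InnerProductSpace ℂ E]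
    [FiniteDimensional ℂ E] {Γ K : ℕ} (F : TimeDepPF.ProductFormula Γ K)
    (V : ℕ) (hV : F.HasLayers V) (p : ℕ) (hp : 1 ≤ p) (t : ℝ) (ht : 0 ≤ t)
    (H : Fin Γ → ℝ → E →L[ℂ] E)
    (hsymm : ∀ g, ∀ τ ∈ Set.Icc 0 t, (H g τ).IsSymmetric)
    (hdiff : ∀ g, ∀ q ≤ p + 1,
      DifferentiableOn ℝ (iteratedDerivWithin q (H g) (Set.Icc 0 t)) (Set.Icc 0 t))
    (hord : F.CounterpartHasOrder p ∨ F.HasOrderFor H p) :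
    ∃ M : ℝ, IsGreatest (TimeDepPF.alphaCom H t p '' Set.Icc 0 t) M ∧
      ‖TimeDepPF.timeEvolution (fun τ => ∑ g, H g τ) t 0 - F.S H t‖
        ≤ 3 * (V : ℝ) ^ (p + 1) * M * t ^ (p + 1) := by
  have := FiniteDimensional.complete ℂ E
  -- For `t = 0` the interval is a point and both operators are `1`; extension and one-sided
  -- derivatives need `t > 0`.
  rcases ht.eq_or_lt with rfl | ht
  · refine ⟨TimeDepPF.alphaCom H 0 p 0, ?_, ?_⟩
    · rw [Set.Icc_self, Set.image_singleton]
      exact isGreatest_singleton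
    · rw [TimeDepPF.timeEvolution_self, F.S_zero]
      simp
  obtain ⟨q, rfl⟩ : ∃ q, p = q + 1 := ⟨p - 1, by omega⟩
  have hex : ∀ g, ∃ H' : ℝ → E →L[ℂ] E, ContDiff ℝ (q + 1 : ℕ) H' ∧
      (∀ x, IsSelfAdjoint (H' x)) ∧ Set.EqOn (H g) H' (Set.Icc 0 t) := fun g => by
    refine TimeDepPF.exists_contDiff_isSelfAdjoint_eqOn_Icc ht (q + 1) ?_ fun x hx =>
      ContinuousLinearMap.isSelfAdjoint_iff_isSymmetric.2 (hsymm g x hx)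
    exact contDiffOn_of_differentiableOn_deriv (n := ((q + 1 : ℕ) : ℕ∞)) fun m hm =>
      hdiff g m ((Nat.cast_le.1 hm).trans (Nat.le_succ _))
  choose H' hC hsa hEq using hex
  have hα : ∀ τ ∈ Set.Icc 0 t, TimeDepPF.alphaCom H t (q + 1) τ =
      ∑ g, TimeDepPF.wordSum (X := E →L[ℂ] E) (TimeDepPF.wordOp H') (q + 1) (H' g) τ :=
    fun τ hτ => TimeDepPF.alphaCom_eq ht hC hEq hτ
  have hcont : ContinuousOn (TimeDepPF.alphaCom H t (q + 1)) (Set.Icc 0 t) := by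
    refine ContinuousOn.congr (Continuous.continuousOn ?_) hα
    exact continuous_finsetSum _ fun g _ => TimeDepPF.continuous_wordSum hC g
  obtain ⟨τ, hτ, hmax⟩ := isCompact_Icc.exists_isMaxOn (Set.nonempty_Icc.2 ht.le) hcont
  refine ⟨TimeDepPF.alphaCom H t (q + 1) τ, ⟨Set.mem_image_of_mem _ hτ, ?_⟩, ?_⟩
  · rintro _ ⟨σ, hσ, rfl⟩
    exact hmax hσ
  have hsum : Set.EqOn (fun τ => ∑ g, H g τ) (fun τ => ∑ g, H' g τ) (Set.Icc 0 t) :=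
    fun x hx => Finset.sum_congr rfl fun g _ => hEq g hx
  have h0 : (0 : ℝ) ∈ Set.Icc 0 t := ⟨le_rfl, ht.le⟩
  rw [TimeDepPF.timeEvolution_congr hsum h0 (Set.right_mem_Icc.2 ht.le),
    F.S_congr hEq (Set.right_mem_Icc.2 ht.le)]
  refine TimeDepPF.norm_timeEvolution_sub_S_le hV hC hsa ht (fun σ hσ => ?_) ?_
  · rw [← hα σ hσ]
    exact hmax hσ
  · rcases hord with hord | hord
    · exact hord.hasOrderFor hC hsa
    · refine Asymptotics.IsBigO.congr' hord ?_ Filter.EventuallyEq.rfl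
      filter_upwards [Ioc_mem_nhdsGT ht] with s hs
      have hs' : s ∈ Set.Icc 0 t := ⟨hs.1.le, hs.2⟩
      rw [TimeDepPF.timeEvolution_congr hsum h0 hs', F.S_congr hEq hs']
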